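/- Conventions. All digraphs are finite, without multiple edges. A digraph is \emph{acyclic} if it has no directed cycle; an acyclic digraph is a \emph{cactus} (a \emph{tree}) if its underlying undirected graph is connected and every edge lies on at most one cycle (is connected and has no cycle). An edge $(u,v)$ of an acyclic digraph is \emph{transitive} if there is a directed path from $u$ to $v$ other than the edge itself. In an \emph{L-drawing} the vertices are points of the plane with pairwise distinct $x$-coordinates and pairwise distinct $y$-coordinates, and each edge $(u,v)$ is the vertical segment from $u$ to the bend $(x(u),y(v))$ followed by the horizontal segment from the bend to $v$. It is \emph{upward-leftward} if $y(u)<y(v)$ and $x(v)<x(u)$ for every edge $(u,v)$, \emph{planar} if distinct edges do not cross (they may overlap), and \emph{outerplanar} if it is planar and every vertex is incident to the unbounded face. A \emph{plane embedding} consists of the counterclockwise cyclic order of the edges around each vertex in a planar drawing together with the choice of the outer face; it is \emph{outerplanar} if every vertex is incident to the outer face. (In an L-drawing, overlapping edges are ordered as if they were pulled slightly apart without creating a crossing.) Theorem. Let $G$ be an acyclic cactus with $n$ vertices that has exactly one source or exactly one sink. Then $G$ has an upward-leftward outerplanar L-drawing. Moreover, if $G$ has no transitive edges (for example, if $G$ is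 a tree), then for every given outerplanar embedding of $G$ such a drawing can be chosen so that it maintains the given embedding, i.e., the cyclic orders around the vertices and the outer face. In both cases the drawing can be chosen so that the $x$-coordinates of the vertices are the numbers $1,\dots,n$, and so are the $y$-coordinates. -/

import Mathlib

/-! ### Digraphs -/

namespace Digraph

variable {V : Type*} (G : Digraph V)

/-- There is no directed closed walk. In particular there are no loops and no pairs of antiparallel
edges, so that the edges of `G` correspond to the edges of `G.toSimpleGraphInclusive`, the
underlying undirected graph. -/
def IsAcyclic : Prop := ∀ v, ¬ Relation.TransGen G.Adj v v

/-- A source is only incident to outgoing edges. -/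
def IsSource (s : V) : Prop := ∀ u, ¬ G.Adj u s

/-- A sink is only incident to incoming edges. -/
def IsSink (t : V) : Prop := ∀ u, ¬ G.Adj t u

/-- An edge from `u` to `v` of an acyclic digraph is transitive if some other directed path leads
from `u` to `v`. (The second vertex `w` of that path is different from `v`.) -/
def IsTransitiveEdge (u v : V) : Prop :=
  G.Adj u v ∧ ∃ w, w ≠ v ∧ G.Adj u w ∧ Relation.ReflTransGen G.Adj w v

end Digraph

/-- A cactus is a connected graph in which every edge lies on at most one cycle. -/
def SimpleGraph.IsCactus {V : Type*} (H : SimpleGraph V) : Prop :=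
  H.Connected ∧
    ∀ ⦃u v : V⦄ (p : H.Walk u u) (q : H.Walk v v), p.IsCycle → q.IsCycle →
      ∀ e, e ∈ p.edges → e ∈ q.edges → p.toSubgraph = q.toSubgraph

/-! ### Combinatorial embeddings

A dart `d` of a graph is an edge together with a direction, leading from `d.fst` to `d.snd`. -/

/-- The face permutation of a rotation `rot`, where `rot d` is the dart that follows `d` in
counterclockwise direction around its initial vertex `d.fst`. Walking along `d` with a face to the
left, one continues at `d.snd` with the dart that follows the reversal of `d` in clockwise
direction. Thus the orbit of `d` is the boundary walk of the face to the left of `d`. -/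
def SimpleGraph.facePerm {V : Type*} {H : SimpleGraph V} (rot : Equiv.Perm H.Dart) :
    Equiv.Perm H.Dart :=
  rot⁻¹ * (SimpleGraph.Dart.symm_involutive (G := H)).toPerm

/-- The number of faces of a rotation of a connected graph: the number of orbits of the face
permutation, except that a single vertex without edges has one face. -/
noncomputable def SimpleGraph.numFaces {V : Type*} {H : SimpleGraph V}
    (rot : Equiv.Perm H.Dart) : ℕ :=
  max 1 (Nat.card (Quotient (Equiv.Perm.SameCycle.setoid (SimpleGraph.facePerm rot))))

/-- A planar embedding (up to equivalence) of a finite connected graph with a fixed outer face: a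
counterclockwise cyclic order of the edges around each vertex that satisfies Euler's formula for the
plane, and a face, given as the set of darts that have this face to their left. -/
structure PlaneEmbedding {V : Type*} (H : SimpleGraph V) where
  /-- The dart that follows a given dart in counterclockwise order around its initial vertex. -/
  rot : Equiv.Perm H.Dart
  rot_fst : ∀ d, (rot d).fst = d.fst
  rot_cyclic : ∀ d e : H.Dart, d.fst = e.fst → rot.SameCycle d e
  /-- Euler's formula. -/
  euler : Nat.card V + SimpleGraph.numFaces rot = Nat.card H.edgeSet + 2
  /-- The darts on the boundary of the outer face. -/
  outer : Set H.Dart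
  outer_face : (∃ d, outer = {e | (SimpleGraph.facePerm rot).SameCycle d e}) ∨ IsEmpty H.Dart

/-- Every vertex is incident to the outer face. (The graph with one vertex has no darts.) -/
def PlaneEmbedding.IsOuterplanar {V : Type*} {H : SimpleGraph V} (P : PlaneEmbedding H) : Prop :=
  (∀ v, ∃ d ∈ P.outer, d.fst = v) ∨ IsEmpty H.Dart

/-! ### L-drawings -/

/-- An L-drawing with vertex set `V`: the vertices have exclusive x- and y-coordinates. An edge from
`u` to `v` is drawn as the vertical segment from `u` to the bend `(x u, y v)`, followed by the
horizontal segment from the bend to `v`. -/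
structure LDrawing (V : Type*) where
  x : V → ℝ
  y : V → ℝ
  x_injective : Function.Injective x
  y_injective : Function.Injective y

namespace LDrawing

variable {V : Type*} (D : LDrawing V)

/-- The point that represents a vertex. -/
def point (v : V) : ℝ × ℝ := (D.x v, D.y v)

/-- The bend of the edge from `u` to `v`. -/
def bend (u v : V) : ℝ × ℝ := (D.x u, D.y v)

/-- Distinct edges may overlap but not cross. As coordinates are exclusive, no edge contains a vertex
other than its end vertices, two vertical segments intersect only if the edges have the same tail,
two horizontal segments intersect only if the edges have the same head (both are overlaps), and a
vertical and a horizontal segment cross if and only if their relative interiors intersect. -/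
def IsPlanar (G : Digraph V) : Prop :=
  ∀ ⦃u v u' v' : V⦄, G.Adj u v → G.Adj u' v' →
    Disjoint (openSegment ℝ (D.point u) (D.bend u v)) (openSegment ℝ (D.bend u' v') (D.point v'))

/-- All edges point upward and to the left. -/
def IsUpwardLeftward (G : Digraph V) : Prop :=
  ∀ ⦃u v : V⦄, G.Adj u v → D.y u < D.y v ∧ D.x v < D.x u

/-- The set of all points of the plane that are covered by the drawing. -/
def support (G : Digraph V) : Set (ℝ × ℝ) :=
  Set.range D.point ∪
    {z | ∃ u v, G.Adj u v ∧
      (z ∈ segment ℝ (D.point u) (D.bend u v) ∨ z ∈ segment ℝ (D.bend u v) (D.point v))}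

/-- The outer face: the unbounded connected component of the complement of the drawing. -/
def outerFace (G : Digraph V) : Set (ℝ × ℝ) :=
  {z | z ∉ D.support G ∧
    ¬ Bornology.IsBounded (connectedComponentIn (D.support G)ᶜ z)}

/-- The drawing is planar and all vertices are incident to the outer face. -/
def IsOuterplanar (G : Digraph V) : Prop :=
  D.IsPlanar G ∧ ∀ v, D.point v ∈ closure (D.outerFace G)

/-- The counterclockwise order, starting from the downward direction, of the darts around a vertex
`v` of an upward-leftward planar L-drawing, for darts `d` and `e` with `d.fst = e.fst = v`.

The incoming edges of `v` leave the point `v` to the right and then bend downwards; where two of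
them overlap, the one whose tail is farther to the right passes above the other. They are followed
by the outgoing edges of `v`, which leave the point `v` upwards and then bend to the left; where two
of them overlap, the one with the higher head passes to the right of the other. -/
def CcwBefore (G : Digraph V) (d e : G.toSimpleGraphInclusive.Dart) : Prop :=
  (G.Adj d.snd d.fst ∧ G.Adj e.fst e.snd) ∨
  (G.Adj d.snd d.fst ∧ G.Adj e.snd e.fst ∧ D.x d.snd < D.x e.snd) ∨
  (G.Adj d.fst d.snd ∧ G.Adj e.fst e.snd ∧ D.y e.snd < D.y d.snd)

/-- Traversing the darts around a vertex counterclockwise from `d`, one meets `e` strictly before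
`f`. -/
def CcwBetween (G : Digraph V) (d e f : G.toSimpleGraphInclusive.Dart) : Prop :=
  (D.CcwBefore G d e ∧ D.CcwBefore G e f) ∨
  (D.CcwBefore G e f ∧ D.CcwBefore G f d) ∨
  (D.CcwBefore G f d ∧ D.CcwBefore G d e)

/-- An upward-leftward planar L-drawing maintains a given plane embedding: the given rotation maps
each dart to the next one in the counterclockwise order of the drawing, and the given outer face is
the outer face of the drawing. In the drawing, no point lies below the lowest vertex, so the face to
the left of the leftmost outgoing edge of that vertex, which is the one with the lowest head, is
the outer face. -/
def Maintains (G : Digraph V) (P : PlaneEmbedding G.toSimpleGraphInclusive) : Prop :=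
  (∀ d e : G.toSimpleGraphInclusive.Dart, e.fst = d.fst → ¬ D.CcwBetween G d e (P.rot d)) ∧
  (∀ d : G.toSimpleGraphInclusive.Dart, (∀ v, D.y d.fst ≤ D.y v) →
    (∀ w, G.Adj d.fst w → D.y d.snd ≤ D.y w) → d ∈ P.outer)

/-- The x-coordinates of the vertices are the numbers `1, …, n`, and so are the y-coordinates, where
`n` is the number of vertices. -/
def OnGrid : Prop :=
  Set.range D.x = (fun k : ℕ => (k : ℝ)) '' Set.Icc 1 (Nat.card V) ∧
  Set.range D.y = (fun k : ℕ => (k : ℝ)) '' Set.Icc 1 (Nat.card V)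

end LDrawing

/-!
The case of a single sink reduces to that of a single source: reverse all edges and exchange the two
coordinates. This reflects the plane, so a given embedding is replaced by its mirror image. Hence
let `s` be the only source. Then every vertex is reachable from `s`, and `V` is ordered by
reachability.

*Dominance drawings.* Suppose the outgoing edges of every vertex are ordered from left to right. Two
vertices `u`, `v` without a directed path between them are separated at a maximal common ancestor
`w`, where different outgoing edges lead to `u` and to `v`; the order of these edges decides whether
`u` is to the left of `v` (`Digraph.LeftOf`). If this relation and its unions with reachability and
with the converse of reachability are transitive, then there is a drawing in which `u` is below `v`
if and only if `u` is a proper ancestor of `v` or to the left of it, and in which `u` has the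
smaller x-coordinate if and only if `u` is a proper descendant of `v` or to the left of it
(`LDrawing.IsDominance`). All edges point upward and to the left.

*Cactus cycles.* Because of the single source, the cycles appear as pairs of directed paths with
common ends (`Digraph.Bigon`), and a cactus allows no two different bigons with a common edge. So
`w` above is unique, and an inner vertex of a side of a cycle has one incoming edge and lies inside
a side of no other cycle. `Digraph.IsOuterplanarKey` collects the conditions that the left-to-right
orders have to satisfy at the cycles. They imply that the relations above are transitive
(`Digraph.IsRootedCactus.leftOf_trans`) and that no two edges cross
(`Digraph.IsRootedCactus.not_crossing`). A vertex that is not on the right side of a cycle sees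
infinity on the ray to its left; any other vertex sees it along a path that climbs just to the right
of the vertex past all its descendants and then turns left (`LDrawing.IsDominance.isOuterplanar`).

*Choosing the orders.* In an arbitrary cactus one orients each cycle such that a transitive edge is
its right side (`Digraph.IsRootedCactus.exists_isOuterplanarKey`). If there are no transitive edges
and an embedding is given, then one cuts open the rotation at every vertex and reads off the order
of the outgoing edges. That this order meets the conditions is a fact about the darts which have the
interior of a cycle to their left. To identify them, let a unit of flow circulate along a cycle `C`.
Euler's formula says that every circulation is the coboundary of a function on the faces
(`PlaneEmbedding.exists_face_potential`), here the winding number around the faces. As every vertex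
is incident to the outer face and `C` has no chords, the darts with nonzero winding number form one
side of `C`, and they are consecutive around each vertex of `C` (`PlaneEmbedding.exists_inner`).
Then the counterclockwise order of the dominance drawing is that of the cut rotations
(`Digraph.IsCut.pos_lt_of_precedes`). The leftmost edge at `s` is on the outer face by the choice of
the cut; for the reflected drawing the same is needed at the leftmost vertex, where the outer face
arrives from `s` along leftmost edges (`Digraph.IsCut.exists_leftmost_sink`).
-/

/-! ### Directed walks and bigons -/

/-- The graph `H` is the underlying undirected graph of the acyclic digraph `G`, and the order of
the vertex set is reachability in `G`. -/
structure Digraph.IsReachOrder {V : Type*} [PartialOrder V] (G : Digraph V) (H : SimpleGraph V) :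
    Prop where
  le_iff : ∀ u v, u ≤ v ↔ Relation.ReflTransGen G.Adj u v
  adj_iff : ∀ u v, H.Adj u v ↔ G.Adj u v ∨ G.Adj v u
  adj_lt : ∀ {u v}, G.Adj u v → u < v

/-- A walk of the underlying graph that follows the directions of the edges. -/
def SimpleGraph.Walk.IsDirected {V : Type*} (G : Digraph V) {H : SimpleGraph V} {a b : V}
    (p : H.Walk a b) : Prop :=
  ∀ d ∈ p.darts, G.Adj d.fst d.snd

namespace SimpleGraph.Walk

variable {V : Type*} {G : Digraph V} {H : SimpleGraph V}

theorem isDirected_cons {a b c : V} {hab : H.Adj a b} {p : H.Walk b c} :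
    (cons hab p).IsDirected G ↔ G.Adj a b ∧ p.IsDirected G := by
  simp [IsDirected]

theorem isDirected_append {a b c : V} {p : H.Walk a b} {q : H.Walk b c} :
    (p.append q).IsDirected G ↔ p.IsDirected G ∧ q.IsDirected G := by
  simp only [IsDirected, darts_append, List.mem_append]
  exact ⟨fun h => ⟨fun d hd => h d (.inl hd), fun d hd => h d (.inr hd)⟩,
    fun h d hd => hd.elim (h.1 d) (h.2 d)⟩

end SimpleGraph.Walk

/-- Two directed walks with the same ends that have only their ends in common, and that are not
both the same edge, as one of them has an inner vertex. They form a cycle with a single source `r`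
and a single sink `t`. -/
structure Digraph.Bigon {V : Type*} (G : Digraph V) (H : SimpleGraph V) (r t : V) where
  P : H.Walk r t
  Q : H.Walk r t
  directed_P : P.IsDirected G
  directed_Q : Q.IsDirected G
  ne : r ≠ t
  meet : ∀ x ∈ P.support, x ∈ Q.support → x = r ∨ x = t
  inner : ∃ x, x ≠ r ∧ x ≠ t ∧ (x ∈ P.support ∨ x ∈ Q.support)

theorem exists_maximal_common_lower_bound {V : Type*} [PartialOrder V] [Finite V] {w u v : V}
    (hu : w ≤ u) (hv : w ≤ v) : ∃ m, w ≤ m ∧ Maximal (fun x => x ≤ u ∧ x ≤ v) m :=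
  (Set.toFinite {x | x ≤ u ∧ x ≤ v}).exists_le_maximal (a := w) ⟨hu, hv⟩

namespace Digraph

/-- The edge set of a bigon. -/
def Bigon.edges {V : Type*} {G : Digraph V} {H : SimpleGraph V} {r t : V} (B : G.Bigon H r t) :
    Set (Sym2 V) := {e | e ∈ B.P.edges ∨ e ∈ B.Q.edges}

/-- The closed walk around a bigon. -/
def Bigon.cycle {V : Type*} {G : Digraph V} {H : SimpleGraph V} {r t : V} (B : G.Bigon H r t) :
    H.Walk r r := B.P.append B.Q.reverse

namespace IsReachOrder

variable {V : Type*} [PartialOrder V] {G : Digraph V} {H : SimpleGraph V}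

open SimpleGraph

theorem exists_walk (h : G.IsReachOrder H) {a b : V} (hab : a ≤ b) :
    ∃ p : H.Walk a b, p.IsDirected G := by
  rw [h.le_iff] at hab
  induction hab using Relation.ReflTransGen.head_induction_on with
  | refl => exact ⟨.nil, by simp [Walk.IsDirected]⟩
  | head hac _ ih =>
    obtain ⟨p, hp⟩ := ih
    refine ⟨.cons ((h.adj_iff _ _).2 (Or.inl hac)) p, ?_⟩
    intro d hd
    rw [Walk.darts_cons, List.mem_cons] at hd
    rcases hd with rfl | hd
    · exact hac
    · exact hp d hd

theorem exists_adj_le (h : G.IsReachOrder H) {a b : V} (hab : a < b) :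
    ∃ c, G.Adj a c ∧ c ≤ b := by
  rcases Relation.ReflTransGen.cases_head ((h.le_iff _ _).1 hab.le) with h1 | ⟨c, h1, h2⟩
  · exact absurd h1 hab.ne
  · exact ⟨c, h1, (h.le_iff _ _).2 h2⟩

theorem exists_le_adj (h : G.IsReachOrder H) {a b : V} (hab : a < b) :
    ∃ c, a ≤ c ∧ G.Adj c b := by
  rcases Relation.ReflTransGen.cases_tail ((h.le_iff _ _).1 hab.le) with h1 | ⟨c, h1, h2⟩
  · exact absurd h1 hab.ne'
  · exact ⟨c, (h.le_iff _ _).2 h1, h2⟩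

theorem le_of_isDirected (h : G.IsReachOrder H) {a b : V} {p : H.Walk a b}
    (hp : p.IsDirected G) {x : V} (hx : x ∈ p.support) : a ≤ x ∧ x ≤ b := by
  induction p generalizing x with
  | nil => simp at hx; simp [hx]
  | cons hab p ih =>
    rw [Walk.isDirected_cons] at hp
    have hlt := h.adj_lt hp.1
    rw [Walk.support_cons, List.mem_cons] at hx
    rcases hx with rfl | hx
    · exact ⟨le_rfl, hlt.le.trans (ih hp.2 p.start_mem_support).2⟩
    · exact ⟨hlt.le.trans (ih hp.2 hx).1, (ih hp.2 hx).2⟩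

theorem isPath_of_isDirected (h : G.IsReachOrder H) {a b : V} {p : H.Walk a b}
    (hp : p.IsDirected G) : p.IsPath := by
  induction p with
  | nil => simp
  | cons hab p ih =>
    rw [Walk.isDirected_cons] at hp
    rw [Walk.cons_isPath_iff]
    exact ⟨ih hp.2, fun hmem => ((h.le_of_isDirected hp.2 hmem).1.trans_lt (h.adj_lt hp.1)).false⟩

theorem adj_unique_of_isDirected (h : G.IsReachOrder H) {a b : V} {p : H.Walk a b}
    (hp : p.IsDirected G) {x y y' : V} (hy : s(x, y) ∈ p.edges) (hy' : s(x, y') ∈ p.edges)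
    (hxy : G.Adj x y) (hxy' : G.Adj x y') : y = y' := by
  induction p with
  | nil => simp at hy
  | @cons a c b hac p ih =>
    rw [Walk.isDirected_cons] at hp
    have key : ∀ z w : V, s(z, w) ∈ p.edges → G.Adj z w → z ≠ a := fun z w hz _ hza => by
      have := (h.le_of_isDirected hp.2 (Walk.fst_mem_support_of_mem_edges p hz)).1
      exact (this.trans_lt (hza ▸ h.adj_lt hp.1)).false
    have key2 : ∀ z w : V, s(z, w) = s(a, c) → G.Adj z w → z = a ∧ w = c := fun z w hz hzw => by
      rw [Sym2.eq_iff] at hz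
      rcases hz with hz | ⟨rfl, rfl⟩
      · exact hz
      · exact absurd (h.adj_lt hzw) (h.adj_lt hp.1).asymm
    rw [Walk.edges_cons, List.mem_cons] at hy hy'
    rcases hy with hy | hy <;> rcases hy' with hy' | hy'
    · rw [(key2 _ _ hy hxy).2, (key2 _ _ hy' hxy').2]
    · exact absurd (key2 _ _ hy hxy).1 (key _ _ hy' hxy')
    · exact absurd (key2 _ _ hy' hxy').1 (key _ _ hy hxy)
    · exact ih hp.2 hy hy'

/-- A directed walk that uses an edge between its ends consists of that edge. -/
theorem support_of_edge_mem (h : G.IsReachOrder H) {a b : V} {p : H.Walk a b}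
    (hp : p.IsDirected G) (hab : s(a, b) ∈ p.edges) {x : V} (hx : x ∈ p.support) :
    x = a ∨ x = b := by
  cases p with
  | nil => simp at hab
  | @cons a c b hac p =>
    have hp' := Walk.isDirected_cons.1 hp
    have hlt : a < b := (h.adj_lt hp'.1).trans_le (h.le_of_isDirected hp'.2 p.start_mem_support).2
    have hadj : G.Adj a b :=
      ((h.adj_iff _ _).1 (Walk.adj_of_mem_edges _ hab)).resolve_right
        fun h' => hlt.asymm (h.adj_lt h')
    have hcb : c = b := h.adj_unique_of_isDirected hp (by simp) hab hp'.1 hadj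
    subst hcb
    rw [Walk.support_cons, List.mem_cons] at hx
    refine hx.imp_right fun hx => ?_
    exact le_antisymm (h.le_of_isDirected hp'.2 hx).2 (h.le_of_isDirected hp'.2 hx).1

end IsReachOrder

namespace Bigon

variable {V : Type*} {G : Digraph V} {H : SimpleGraph V} {r t : V}

open SimpleGraph

theorem mem_edges_cycle (B : G.Bigon H r t) {e : Sym2 V} : e ∈ B.cycle.edges ↔ e ∈ B.edges := by
  simp [cycle, edges, Walk.edges_append]

theorem exists_edge_left (B : G.Bigon H r t) : ∃ x, s(r, x) ∈ B.edges := by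
  have hnil : ¬ B.P.Nil := Walk.not_nil_of_ne B.ne
  exact ⟨_, Or.inl (Walk.mk_start_snd_mem_edges hnil)⟩

theorem exists_edge_right (B : G.Bigon H r t) : ∃ x, s(x, t) ∈ B.edges := by
  have hnil : ¬ B.P.Nil := Walk.not_nil_of_ne B.ne
  exact ⟨_, Or.inl (Walk.mk_penultimate_end_mem_edges hnil)⟩

variable [PartialOrder V]

theorem le (B : G.Bigon H r t) (h : G.IsReachOrder H) {x y : V} (hx : s(x, y) ∈ B.edges) :
    r ≤ x ∧ x ≤ t := by
  rcases hx with hx | hx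
  · exact h.le_of_isDirected B.directed_P (Walk.fst_mem_support_of_mem_edges _ hx)
  · exact h.le_of_isDirected B.directed_Q (Walk.fst_mem_support_of_mem_edges _ hx)

theorem le' (B : G.Bigon H r t) (h : G.IsReachOrder H) {x y : V} (hx : s(x, y) ∈ B.edges) :
    r ≤ y ∧ y ≤ t := B.le h (Sym2.eq_swap ▸ hx)

theorem edges_disjoint (B : G.Bigon H r t) (h : G.IsReachOrder H) {e : Sym2 V}
    (hP : e ∈ B.P.edges) (hQ : e ∈ B.Q.edges) : False := by
  obtain ⟨x, hxr, hxt, hx⟩ := B.inner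
  induction e with
  | _ a b =>
  have hab : a ≠ b := (Walk.adj_of_mem_edges _ hP).ne
  have ha := B.meet a (Walk.fst_mem_support_of_mem_edges _ hP)
    (Walk.fst_mem_support_of_mem_edges _ hQ)
  have hb := B.meet b (Walk.snd_mem_support_of_mem_edges _ hP)
    (Walk.snd_mem_support_of_mem_edges _ hQ)
  have hrt : s(a, b) = s(r, t) := by
    rcases ha with rfl | rfl <;> rcases hb with rfl | rfl
    · exact absurd rfl hab
    · rfl
    · exact Sym2.eq_swap
    · exact absurd rfl hab
  rw [hrt] at hP hQ
  rcases hx with hx | hx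
  · exact (h.support_of_edge_mem B.directed_P hP hx).elim hxr hxt
  · exact (h.support_of_edge_mem B.directed_Q hQ hx).elim hxr hxt

theorem isCycle (B : G.Bigon H r t) (h : G.IsReachOrder H) : B.cycle.IsCycle := by
  have hP := h.isPath_of_isDirected B.directed_P
  have hQ := h.isPath_of_isDirected B.directed_Q
  have hQ' := hQ.reverse
  refine { edges_nodup := ?_, ne_nil := ?_, support_nodup := ?_ }
  · rw [cycle, Walk.edges_append, List.nodup_append']
    refine ⟨hP.isTrail.edges_nodup, hQ'.isTrail.edges_nodup, ?_⟩
    intro e he he'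
    rw [Walk.edges_reverse, List.mem_reverse] at he'
    exact B.edges_disjoint h he he'
  · intro hnil
    have := congrArg Walk.length hnil
    rw [cycle, Walk.length_append, Walk.length_nil] at this
    exact B.ne (Walk.eq_of_length_eq_zero (p := B.P) (by omega))
  · rw [cycle, Walk.tail_support_append, List.nodup_append']
    refine ⟨hP.support_nodup.tail, hQ'.support_nodup.tail, ?_⟩
    intro x hx hx'
    have h1 : x ∈ B.P.support := List.mem_of_mem_tail hx
    have h2 : x ∈ B.Q.support := by simpa using List.mem_of_mem_tail hx'
    rcases B.meet x h1 h2 with rfl | rfl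
    · have := hP.support_nodup
      rw [← Walk.cons_tail_support] at this
      exact (List.nodup_cons.1 this).1 hx
    · have := hQ'.support_nodup
      rw [← Walk.cons_tail_support] at this
      exact (List.nodup_cons.1 this).1 hx'

/-- In a cactus, bigons that share an edge coincide. -/
theorem eq_of_mem_edges {r' t' : V} (B : G.Bigon H r t) (B' : G.Bigon H r' t')
    (h : G.IsReachOrder H) (hH : H.IsCactus) {e : Sym2 V} (he : e ∈ B.edges)
    (he' : e ∈ B'.edges) : r = r' ∧ t = t' ∧ B.edges = B'.edges := by
  have hsub := hH.2 B.cycle B'.cycle (B.isCycle h) (B'.isCycle h) e (B.mem_edges_cycle.2 he)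
    (B'.mem_edges_cycle.2 he')
  have hedges : B.edges = B'.edges := by
    ext e
    rw [← B.mem_edges_cycle, ← B'.mem_edges_cycle, ← Walk.mem_edges_toSubgraph,
      ← Walk.mem_edges_toSubgraph, hsub]
  obtain ⟨x, hx⟩ := B.exists_edge_left
  obtain ⟨y, hy⟩ := B.exists_edge_right
  obtain ⟨x', hx'⟩ := B'.exists_edge_left
  obtain ⟨y', hy'⟩ := B'.exists_edge_right
  refine ⟨le_antisymm ?_ ?_, le_antisymm ?_ ?_, hedges⟩
  · exact (B.le h (hedges ▸ hx')).1
  · exact (B'.le h (hedges ▸ hx)).1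
  · exact (B'.le' h (hedges ▸ hy)).2
  · exact (B.le' h (hedges ▸ hy')).2

/-- An inner vertex of a side of a bigon has only one outgoing edge in the bigon. -/
theorem up_unique (B : G.Bigon H r t) (h : G.IsReachOrder H) {x y y' : V} (hx : x ≠ r)
    (hy : s(x, y) ∈ B.edges) (hy' : s(x, y') ∈ B.edges) (hxy : G.Adj x y) (hxy' : G.Adj x y') :
    y = y' := by
  have hxt : x ≠ t := ((h.adj_lt hxy).trans_le (B.le' h hy).2).ne
  rcases hy with hy | hy <;> rcases hy' with hy' | hy'
  · exact h.adj_unique_of_isDirected B.directed_P hy hy' hxy hxy'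
  · exact ((B.meet x (Walk.fst_mem_support_of_mem_edges _ hy)
      (Walk.fst_mem_support_of_mem_edges _ hy')).elim hx hxt).elim
  · exact ((B.meet x (Walk.fst_mem_support_of_mem_edges _ hy')
      (Walk.fst_mem_support_of_mem_edges _ hy)).elim hx hxt).elim
  · exact h.adj_unique_of_isDirected B.directed_Q hy hy' hxy hxy'

/-- The source of a bigon has only two outgoing edges in the bigon. -/
theorem up_root (B : G.Bigon H r t) (h : G.IsReachOrder H) {c d y : V} (hcd : c ≠ d)
    (hc : s(r, c) ∈ B.edges) (hd : s(r, d) ∈ B.edges) (hy : s(r, y) ∈ B.edges) :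
    y = c ∨ y = d := by
  have hadj : ∀ {z}, s(r, z) ∈ B.edges → G.Adj r z := by
    intro z hz
    have hH : H.Adj r z := hz.elim (Walk.adj_of_mem_edges _) (Walk.adj_of_mem_edges _)
    exact ((h.adj_iff _ _).1 hH).resolve_right
      fun h' => ((h.adj_lt h').trans_le (B.le' h hz).1).false
  have hP := fun {y y'} (hy : s(r, y) ∈ B.P.edges) (hy' : s(r, y') ∈ B.P.edges) =>
    h.adj_unique_of_isDirected B.directed_P hy hy' (hadj (.inl hy)) (hadj (.inl hy'))
  have hQ := fun {y y'} (hy : s(r, y) ∈ B.Q.edges) (hy' : s(r, y') ∈ B.Q.edges) =>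
    h.adj_unique_of_isDirected B.directed_Q hy hy' (hadj (.inr hy)) (hadj (.inr hy'))
  rcases hc with hc | hc <;> rcases hd with hd | hd
  · exact absurd (hP hc hd) hcd
  · exact hy.imp (fun hy => hP hy hc) (fun hy => hQ hy hd)
  · exact hy.symm.imp (fun hy => hQ hy hc) (fun hy => hP hy hd)
  · exact absurd (hQ hc hd) hcd

end Bigon

namespace IsReachOrder

variable {V : Type*} [PartialOrder V] [Finite V] {G : Digraph V} {H : SimpleGraph V}

open SimpleGraph

/-- A directed walk `p` from `r` to `v` and two edges `v → f` and `r → d` extend to a bigon below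
any common upper bound `z` of `f` and `d`: close up at a minimal common upper bound. -/
theorem exists_bigon (h : G.IsReachOrder H) {r v f d z : V} (p : H.Walk r v)
    (hp : p.IsDirected G) (hvf : G.Adj v f) (hrd : G.Adj r d) (hfz : f ≤ z) (hdz : d ≤ z)
    (hdv : ¬ d ≤ v) (hne : v ≠ r ∨ f ≠ d) :
    ∃ t, ∃ B : G.Bigon H r t, (∀ e ∈ p.edges, e ∈ B.edges) ∧ s(v, f) ∈ B.edges ∧
      s(r, d) ∈ B.edges ∧ f ≤ t ∧ d ≤ t ∧ t ≤ z := by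
  obtain ⟨t, htz, ht⟩ := (Set.toFinite {x | f ≤ x ∧ d ≤ x}).exists_le_minimal
    (a := z) ⟨hfz, hdz⟩
  obtain ⟨p1, hp1⟩ := h.exists_walk ht.prop.1
  obtain ⟨q1, hq1⟩ := h.exists_walk ht.prop.2
  have hrv : r ≤ v := (h.le_of_isDirected hp p.start_mem_support).2
  have hvt : v < t := (h.adj_lt hvf).trans_le ht.prop.1
  have hvf' : H.Adj v f := (h.adj_iff _ _).2 (.inl hvf)
  have hrd' : H.Adj r d := (h.adj_iff _ _).2 (.inl hrd)
  let B : G.Bigon H r t :=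
    { P := p.append (.cons hvf' p1)
      Q := .cons hrd' q1
      directed_P := Walk.isDirected_append.2 ⟨hp, Walk.isDirected_cons.2 ⟨hvf, hp1⟩⟩
      directed_Q := Walk.isDirected_cons.2 ⟨hrd, hq1⟩
      ne := (hrv.trans_lt hvt).ne
      meet := by
        intro x hx hx'
        rw [Walk.support_cons, List.mem_cons] at hx'
        refine hx'.imp_right fun hx' => ?_
        have hdx := h.le_of_isDirected hq1 hx'
        rw [Walk.mem_support_append_iff, Walk.support_cons, List.mem_cons] at hx
        rcases hx with hx | rfl | hx
        · exact absurd (hdx.1.trans (h.le_of_isDirected hp hx).2) hdv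
        · exact absurd hdx.1 hdv
        · exact ht.eq_of_le ⟨(h.le_of_isDirected hp1 hx).1, hdx.1⟩ hdx.2
      inner := by
        by_cases hvr : v = r
        · have hfd : f ≠ d := hne.resolve_left (by simpa using hvr)
          by_cases hft : f = t
          · exact ⟨d, (h.adj_lt hrd).ne', fun hdt => hfd (hft.trans hdt.symm), .inr (by simp)⟩
          · exact ⟨f, (hrv.trans_lt (h.adj_lt hvf)).ne', hft, .inl (by simp)⟩
        · exact ⟨v, hvr, hvt.ne, .inl (by simp)⟩ }
  refine ⟨t, B, ?_, ?_, ?_, ht.prop.1, ht.prop.2, htz⟩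
  · intro e he
    exact .inl (by simp [B, Walk.edges_append, he])
  · exact .inl (by simp [B, Walk.edges_append])
  · exact .inr (by simp [B])

theorem exists_bigon_root (h : G.IsReachOrder H) {r c d z : V} (hrc : G.Adj r c)
    (hrd : G.Adj r d) (hcd : c ≠ d) (hcz : c ≤ z) (hdz : d ≤ z) :
    ∃ t, ∃ B : G.Bigon H r t, s(r, c) ∈ B.edges ∧ s(r, d) ∈ B.edges := by
  obtain ⟨t, B, -, h1, h2, -⟩ := h.exists_bigon (.nil : H.Walk r r) (by simp [Walk.IsDirected])
    hrc hrd hcz hdz (h.adj_lt hrd).not_ge (.inr hcd)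
  exact ⟨t, B, h1, h2⟩

end IsReachOrder

/-- An acyclic cactus `G`, with underlying graph `H`, that has a vertex `s` from which all vertices
can be reached, ordered by reachability. -/
structure IsRootedCactus {V : Type*} [PartialOrder V] (G : Digraph V) (H : SimpleGraph V)
    (s : V) : Prop extends G.IsReachOrder H where
  isCactus : H.IsCactus
  root_le : ∀ v, s ≤ v

namespace IsRootedCactus

variable {V : Type*} [PartialOrder V] [Finite V] {G : Digraph V} {H : SimpleGraph V} {s : V}

open SimpleGraph

/-- Two edges with the same head are the last edges of a bigon. -/
theorem exists_bigon_sink (h : G.IsRootedCactus H s) {p q v : V} (hpv : G.Adj p v)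
    (hqv : G.Adj q v) (hpq : p ≠ q) :
    ∃ r, ∃ B : G.Bigon H r v, s(p, v) ∈ B.edges ∧ s(q, v) ∈ B.edges := by
  obtain ⟨r, -, hr⟩ := exists_maximal_common_lower_bound (h.root_le p) (h.root_le q)
  obtain ⟨P, hP⟩ := h.exists_walk hr.prop.1
  obtain ⟨Q, hQ⟩ := h.exists_walk hr.prop.2
  have hpv' : H.Adj p v := (h.adj_iff _ _).2 (.inl hpv)
  have hqv' : H.Adj q v := (h.adj_iff _ _).2 (.inl hqv)
  have hp := h.adj_lt hpv
  have hq := h.adj_lt hqv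
  let B : G.Bigon H r v :=
    { P := P.append (.cons hpv' .nil)
      Q := Q.append (.cons hqv' .nil)
      directed_P := Walk.isDirected_append.2
        ⟨hP, Walk.isDirected_cons.2 ⟨hpv, by simp [Walk.IsDirected]⟩⟩
      directed_Q := Walk.isDirected_append.2
        ⟨hQ, Walk.isDirected_cons.2 ⟨hqv, by simp [Walk.IsDirected]⟩⟩
      ne := (hr.prop.1.trans_lt hp).ne
      meet := by
        intro x hx hx'
        simp only [Walk.mem_support_append_iff, Walk.support_cons, Walk.support_nil,
          List.mem_cons, List.not_mem_nil, or_false] at hx hx'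
        by_cases hxv : x = v
        · exact .inr hxv
        have hxp : x ∈ P.support := by
          rcases hx with hx | rfl | hx
          exacts [hx, P.end_mem_support, absurd hx hxv]
        have hxq : x ∈ Q.support := by
          rcases hx' with hx | rfl | hx
          exacts [hx, Q.end_mem_support, absurd hx hxv]
        have h1 := h.le_of_isDirected hP hxp
        have h2 := h.le_of_isDirected hQ hxq
        exact .inl (le_antisymm (hr.le_of_ge ⟨h1.2, h2.2⟩ h1.1) h1.1)
      inner := by
        by_cases hpr : p = r
        · exact ⟨q, fun hqr => hpq (hpr.trans hqr.symm), hq.ne, .inr (by simp)⟩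
        · exact ⟨p, hpr, hp.ne, .inl (by simp)⟩ }
  exact ⟨r, B, .inl (by simp [B, Walk.edges_append]), .inr (by simp [B, Walk.edges_append])⟩

/-- A bigon contains the only incoming edge of each of its vertices other than source and sink. -/
theorem eq_of_mem_bigon (h : G.IsRootedCactus H s) {r t p q v f : V} (B : G.Bigon H r t)
    (hp : s(p, v) ∈ B.edges) (hf : s(v, f) ∈ B.edges) (hpv : G.Adj p v) (hqv : G.Adj q v)
    (hvf : G.Adj v f) : p = q := by
  by_contra hpq
  obtain ⟨r', B', h1, -⟩ := h.exists_bigon_sink hpv hqv hpq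
  obtain ⟨-, ht, -⟩ := B.eq_of_mem_edges B' h.toIsReachOrder h.isCactus hp h1
  exact ((h.adj_lt hvf).trans_le (ht ▸ (B.le' h.toIsReachOrder hf).2)).false

/-- No three out-neighbours of a vertex are linked by common descendants. -/
theorem not_three (h : G.IsRootedCactus H s) {w c d e u v : V} (hc : G.Adj w c) (hd : G.Adj w d)
    (he : G.Adj w e) (hcd : c ≠ d) (hce : c ≠ e) (hde : d ≠ e) (hcu : c ≤ u) (heu : e ≤ u)
    (hdv : d ≤ v) (hev : e ≤ v) : False := by
  obtain ⟨t, B, h1, h2⟩ := h.exists_bigon_root hc he hce hcu heu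
  obtain ⟨t', B', h3, h4⟩ := h.exists_bigon_root hd he hde hdv hev
  obtain ⟨-, -, hB⟩ := B.eq_of_mem_edges B' h.toIsReachOrder h.isCactus h2 h4
  rcases B.up_root h.toIsReachOrder hce h1 h2 (hB ▸ h3) with h5 | h5
  · exact hcd h5.symm
  · exact hde h5

/-- Of two incomparable vertices with common descendants, only one out-neighbour leads to these. -/
theorem not_branch (h : G.IsRootedCactus H s) {w w' c d u v : V} (hww' : ¬ w ≤ w')
    (hw'w : ¬ w' ≤ w) (hc : G.Adj w c) (hd : G.Adj w d) (hcd : c ≠ d) (hcu : c ≤ u)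
    (hw'u : w' ≤ u) (hdv : d ≤ v) (hw'v : w' ≤ v) : False := by
  obtain ⟨r, -, hr⟩ := exists_maximal_common_lower_bound (h.root_le w) (h.root_le w')
  have hrw : r ≠ w := fun hrw => hww' (hrw ▸ hr.prop.2)
  have hrw' : r < w' := lt_of_le_of_ne hr.prop.2 fun hrw => hw'w (hrw ▸ hr.prop.1)
  obtain ⟨e, hre, hew'⟩ := h.exists_adj_le hrw'
  have hew : ¬ e ≤ w := fun hew => by
    have := hr.le_of_ge ⟨hew, hew'⟩ (h.adj_lt hre).le
    exact (this.trans_lt (h.adj_lt hre)).false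
  obtain ⟨p, hp⟩ := h.exists_walk hr.prop.1
  obtain ⟨t, B, -, h1, h2, -⟩ := h.exists_bigon p hp hc hre hcu (hew'.trans hw'u) hew
    (.inl hrw.symm)
  obtain ⟨t', B', -, h3, h4, -⟩ := h.exists_bigon p hp hd hre hdv (hew'.trans hw'v) hew
    (.inl hrw.symm)
  obtain ⟨-, -, hB⟩ := B.eq_of_mem_edges B' h.toIsReachOrder h.isCactus h2 h4
  exact hcd (B.up_unique h.toIsReachOrder hrw.symm h1 (hB ▸ h3) hc hd)

end IsRootedCactus

/-- The vertex `v` lies inside the `c`-side of a cycle with source `r` and first vertices `c` and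
`d`, and `f` follows `v` on that cycle. The cycle itself is recovered in `OnCycle.exists_bigon`. -/
structure OnCycle {V : Type*} [PartialOrder V] (G : Digraph V) (r c d v f : V) : Prop where
  adj_left : G.Adj r c
  adj_right : G.Adj r d
  le : c ≤ v
  not_le : ¬ d ≤ v
  adj : G.Adj v f
  exists_le : ∃ z, f ≤ z ∧ d ≤ z

namespace OnCycle

variable {V : Type*} [PartialOrder V] {G : Digraph V} {H : SimpleGraph V} {s r c d v f : V}

open SimpleGraph

theorem ne (o : G.OnCycle r c d v f) : c ≠ d := fun h => o.not_le (h ▸ o.le)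

variable [Finite V]

theorem exists_bigon (o : G.OnCycle r c d v f) (h : G.IsReachOrder H) :
    ∃ t, ∃ B : G.Bigon H r t, ∃ w : H.Walk c v, w.IsDirected G ∧ (∀ e ∈ w.edges, e ∈ B.edges) ∧
      s(r, c) ∈ B.edges ∧ s(r, d) ∈ B.edges ∧ s(v, f) ∈ B.edges ∧
      ∃ p, G.Adj p v ∧ s(p, v) ∈ B.edges := by
  obtain ⟨z, hfz, hdz⟩ := o.exists_le
  obtain ⟨w, hw⟩ := h.exists_walk o.le
  let p : H.Walk r v := .cons ((h.adj_iff _ _).2 (.inl o.adj_left)) w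
  have hp : p.IsDirected G := Walk.isDirected_cons.2 ⟨o.adj_left, hw⟩
  have hrv : r < v := (h.adj_lt o.adj_left).trans_le o.le
  obtain ⟨t, B, h1, h2, h3, -⟩ := h.exists_bigon p hp o.adj o.adj_right hfz hdz o.not_le
    (.inl hrv.ne')
  refine ⟨t, B, w, hw, fun e he => h1 e (by simp [p, he]), h1 _ (by simp [p]), h3, h2, ?_⟩
  have hmem : s(p.penultimate, v) ∈ p.edges :=
    Walk.mk_penultimate_end_mem_edges (Walk.not_nil_of_ne hrv.ne)
  refine ⟨p.penultimate, ?_, h1 _ hmem⟩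
  refine ((h.adj_iff _ _).1 (Walk.adj_of_mem_edges _ hmem)).resolve_right fun h' => ?_
  exact ((h.adj_lt h').trans_le
    (h.le_of_isDirected hp (Walk.fst_mem_support_of_mem_edges _ hmem)).2).false

/-- The cycle through a vertex `v` in which `v` is neither the source nor the sink is unique. -/
theorem unique (o : G.OnCycle r c d v f) {r' c' d' f' : V} (o' : G.OnCycle r' c' d' v f')
    (h : G.IsRootedCactus H s) : r = r' ∧ c = c' ∧ d = d' ∧ f = f' := by
  obtain ⟨t, B, -, -, -, hc, hd, hf, p, hp, hpv⟩ := o.exists_bigon h.toIsReachOrder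
  obtain ⟨t', B', -, -, -, hc', hd', hf', p', hp', hpv'⟩ := o'.exists_bigon h.toIsReachOrder
  obtain rfl := h.eq_of_mem_bigon B hpv hf hp hp' o.adj
  obtain ⟨rfl, -, hB⟩ := B.eq_of_mem_edges B' h.toIsReachOrder h.isCactus hpv hpv'
  rw [← hB] at hc' hd' hf'
  have hvr : v ≠ r := ((h.adj_lt o.adj_left).trans_le o.le).ne'
  have hcc : c' = c := (B.up_root h.toIsReachOrder o.ne hc hd hc').resolve_right
    fun e => o.not_le (e ▸ o'.le)
  have hdd : d' = d := (B.up_root h.toIsReachOrder o.ne hc hd hd').resolve_left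
    fun e => o'.ne (hcc.trans e.symm)
  exact ⟨rfl, hcc.symm, hdd.symm, B.up_unique h.toIsReachOrder hvr hf hf' o.adj o'.adj⟩

/-- The vertex that follows `v` on a cycle has no common descendant with another out-neighbour of
`v`. -/
theorem not_sibling (o : G.OnCycle r c d v f) (h : G.IsRootedCactus H s) {g z : V}
    (hvg : G.Adj v g) (hfg : f ≠ g) (hfz : f ≤ z) (hgz : g ≤ z) : False := by
  obtain ⟨t, B, -, -, -, -, -, hf, -⟩ := o.exists_bigon h.toIsReachOrder
  obtain ⟨t', B', hf', -⟩ := h.exists_bigon_root o.adj hvg hfg hfz hgz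
  obtain ⟨hr, -⟩ := B.eq_of_mem_edges B' h.toIsReachOrder h.isCactus hf hf'
  exact ((h.adj_lt o.adj_left).trans_le o.le).ne hr

end OnCycle

end Digraph

/-! ### The left-to-right order of incomparable vertices -/

namespace Digraph

/-- A left-to-right order of the outgoing edges of each vertex `v`, given by an integer key `k v w`
for the edge `v → w`, of the kind that an outerplanar drawing induces: the two edges at the source
of a cycle are consecutive, the cycle edge at an inner vertex of the left (right) side of a cycle
is the last (first) one, and a transitive edge lies to the right of the other side of its cycle. -/
structure IsOuterplanarKey {V : Type*} [PartialOrder V] (G : Digraph V) (k : V → V → ℤ) :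
    Prop where
  inj : ∀ {v c d}, G.Adj v c → G.Adj v d → k v c = k v d → c = d
  not_between : ∀ {r c d e z}, G.Adj r c → G.Adj r d → G.Adj r e → c ≤ z → d ≤ z →
    k r c < k r e → k r e < k r d → False
  last_of_left : ∀ {r c d v f g}, G.OnCycle r c d v f → k r c < k r d → G.Adj v g → g ≠ f →
    k v g < k v f
  first_of_right : ∀ {r c d v f g}, G.OnCycle r c d v f → k r d < k r c → G.Adj v g → g ≠ f →
    k v f < k v g
  lt_of_le : ∀ {r c d}, G.Adj r c → G.Adj r d → c ≠ d → c ≤ d → k r c < k r d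

/-- The directed paths from `w` to `u` and to `v` part at `w`: the out-neighbour `c` leads only
to `u`, and `d` leads only to `v`. -/
structure Separates {V : Type*} [PartialOrder V] (G : Digraph V) (w c d u v : V) : Prop where
  adj_left : G.Adj w c
  adj_right : G.Adj w d
  le_left : c ≤ u
  not_le_left : ¬ c ≤ v
  le_right : d ≤ v
  not_le_right : ¬ d ≤ u

/-- The vertex `u` lies to the left of the incomparable vertex `v`. -/
def LeftOf {V : Type*} [PartialOrder V] (G : Digraph V) (k : V → V → ℤ) (u v : V) : Prop :=
  ∃ w c d, G.Separates w c d u v ∧ k w c < k w d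

section

variable {V : Type*} [PartialOrder V] {G : Digraph V} {H : SimpleGraph V} {k : V → V → ℤ}
  {s w c d u v z : V}

theorem Separates.symm (a : G.Separates w c d u v) : G.Separates w d c v u :=
  ⟨a.adj_right, a.adj_left, a.le_right, a.not_le_right, a.le_left, a.not_le_left⟩

theorem LeftOf.not_le (a : G.LeftOf k u v) : ¬ u ≤ v := by
  obtain ⟨w, c, d, a, -⟩ := a
  exact fun huv => a.not_le_left (a.le_left.trans huv)

theorem LeftOf.not_ge (a : G.LeftOf k u v) : ¬ v ≤ u := by
  obtain ⟨w, c, d, a, -⟩ := a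
  exact fun hvu => a.not_le_right (a.le_right.trans hvu)

/-- The order of two out-neighbours decides the order of the vertices they separate. -/
theorem Separates.leftOf_or (a : G.Separates w c d u v) (hk : G.IsOuterplanarKey k) :
    k w c < k w d ∨ G.LeftOf k v u := by
  rcases lt_trichotomy (k w c) (k w d) with h | h | h
  · exact .inl h
  · exact absurd (hk.inj a.adj_left a.adj_right h ▸ a.le_left) a.not_le_right
  · exact .inr ⟨w, d, c, a.symm, h⟩

variable [Finite V]

theorem IsReachOrder.exists_separates (h : G.IsReachOrder H) {w₀ : V} (hu : w₀ ≤ u) (hv : w₀ ≤ v)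
    (huv : ¬ u ≤ v) (hvu : ¬ v ≤ u) : ∃ w c d, w₀ ≤ w ∧ G.Separates w c d u v := by
  obtain ⟨m, hm, hmax⟩ := exists_maximal_common_lower_bound hu hv
  obtain ⟨c, hc, hcu⟩ := h.exists_adj_le (lt_of_le_of_ne hmax.prop.1 fun e => huv (e ▸ hmax.prop.2))
  obtain ⟨d, hd, hdv⟩ := h.exists_adj_le (lt_of_le_of_ne hmax.prop.2 fun e => hvu (e ▸ hmax.prop.1))
  refine ⟨m, c, d, hm, hc, hd, hcu, fun hcv => ?_, hdv, fun hdu => ?_⟩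
  · exact ((hmax.le_of_ge ⟨hcu, hcv⟩ (h.adj_lt hc).le).trans_lt (h.adj_lt hc)).false
  · exact ((hmax.le_of_ge ⟨hdu, hdv⟩ (h.adj_lt hd).le).trans_lt (h.adj_lt hd)).false

namespace IsRootedCactus

/-- Two vertices are separated at one vertex only: a second such vertex, whether comparable with the
first one or not, would give rise to two cycles with a common edge. -/
theorem separates_unique (h : G.IsRootedCactus H s) {w' c' d' : V} (a : G.Separates w c d u v)
    (b : G.Separates w' c' d' u v) : w = w' := by
  have key : ∀ {w c d w' c' d' : V}, G.Separates w c d u v → G.Separates w' c' d' u v →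
      ¬ w < w' := fun {w c d w' c' d'} a b hww' => by
    obtain ⟨e, he, hew'⟩ := h.exists_adj_le hww'
    have heu := (hew'.trans (h.adj_lt b.adj_left).le).trans b.le_left
    have hev := (hew'.trans (h.adj_lt b.adj_right).le).trans b.le_right
    exact h.not_three a.adj_left a.adj_right he (fun e => a.not_le_right (e ▸ a.le_left))
      (fun e => a.not_le_left (e ▸ hev)) (fun e => a.not_le_right (e ▸ heu)) a.le_left heu
      a.le_right hev
  by_contra hne
  have h1 : ¬ w ≤ w' := fun hle => key a b (lt_of_le_of_ne hle hne)
  have h2 : ¬ w' ≤ w := fun hle => key b a (lt_of_le_of_ne hle (Ne.symm hne))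
  exact h.not_branch h1 h2 a.adj_left a.adj_right (fun e => a.not_le_right (e ▸ a.le_left))
    a.le_left ((h.adj_lt b.adj_left).le.trans b.le_left) a.le_right
    ((h.adj_lt b.adj_right).le.trans b.le_right)

theorem leftOf_asymm (h : G.IsRootedCactus H s) (hk : G.IsOuterplanarKey k)
    (huv : G.LeftOf k u v) (hvu : G.LeftOf k v u) : False := by
  obtain ⟨w, c, d, a, hcd⟩ := huv
  obtain ⟨w', c', d', b, hcd'⟩ := hvu
  obtain rfl := h.separates_unique a b.symm
  rcases lt_trichotomy (k w d) (k w d') with h1 | h1 | h1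
  · exact hk.not_between a.adj_left b.adj_right a.adj_right a.le_left b.le_right hcd h1
  · exact b.not_le_right (hk.inj a.adj_right b.adj_right h1 ▸ a.le_right)
  · exact hk.not_between b.adj_left a.adj_right b.adj_right b.le_left a.le_right hcd' h1

theorem leftOf_or_leftOf (h : G.IsRootedCactus H s) (hk : G.IsOuterplanarKey k)
    (huv : ¬ u ≤ v) (hvu : ¬ v ≤ u) : G.LeftOf k u v ∨ G.LeftOf k v u := by
  obtain ⟨w, c, d, -, a⟩ := h.exists_separates (h.root_le u) (h.root_le v) huv hvu
  exact (a.leftOf_or hk).imp_left fun hcd => ⟨w, c, d, a, hcd⟩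

/-- What branches off the right side of a cycle lies to the right of everything above its sink. -/
theorem leftOf_of_right (h : G.IsRootedCactus H s) (hk : G.IsOuterplanarKey k) (hc : G.Adj w c)
    (hd : G.Adj w d) (hcd : k w c < k w d) (hcu : c ≤ u) (hdu : d ≤ u) (hdv : d ≤ v)
    (hcv : ¬ c ≤ v) (hvu : ¬ v ≤ u) : G.LeftOf k u v := by
  obtain ⟨m, f, g, hdm, a⟩ := h.exists_separates hdu hdv (fun huv => hcv (hcu.trans huv)) hvu
  have hmv : m ≤ v := (h.adj_lt a.adj_right).le.trans a.le_right
  have o : G.OnCycle w d c m f :=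
    ⟨hd, hc, hdm, fun hcm => hcv (hcm.trans hmv), a.adj_left, u, a.le_left, hcu⟩
  exact ⟨m, f, g, a, hk.first_of_right o hcd a.adj_right
    fun e => a.not_le_right (e ▸ a.le_left)⟩

/-- What branches off the left side of a cycle lies to the left of everything above its sink. -/
theorem leftOf_of_left (h : G.IsRootedCactus H s) (hk : G.IsOuterplanarKey k) (hc : G.Adj w c)
    (hd : G.Adj w d) (hcd : k w c < k w d) (hcu : c ≤ u) (hdu : d ≤ u) (hcv : c ≤ v)
    (hdv : ¬ d ≤ v) (hvu : ¬ v ≤ u) : G.LeftOf k v u := by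
  obtain ⟨m, f, g, hcm, a⟩ := h.exists_separates hcu hcv (fun huv => hdv (hdu.trans huv)) hvu
  have hmv : m ≤ v := (h.adj_lt a.adj_right).le.trans a.le_right
  have o : G.OnCycle w c d m f :=
    ⟨hc, hd, hcm, fun hdm => hdv (hdm.trans hmv), a.adj_left, u, a.le_left, hdu⟩
  exact ⟨m, g, f, a.symm, hk.last_of_left o hcd a.adj_right
    fun e => a.not_le_right (e ▸ a.le_left)⟩

/-- At a maximal common ancestor `w` of all three vertices, an edge that leads to two of them would
decide the order of these two relative to the third in the same way. So three different edges at
`w` lead to the three vertices, and these would be cyclically ordered. -/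
theorem leftOf_not_cyclic (h : G.IsRootedCactus H s) (hk : G.IsOuterplanarKey k)
    (huv : G.LeftOf k u v) (hvz : G.LeftOf k v z) (hzu : G.LeftOf k z u) : False := by
  obtain ⟨w, -, hw⟩ := (Set.toFinite {x | x ≤ u ∧ x ≤ v ∧ x ≤ z}).exists_le_maximal
    (a := s) ⟨h.root_le u, h.root_le v, h.root_le z⟩
  obtain ⟨hwu, hwv, hwz⟩ := hw.prop
  have hmax : ∀ {e}, G.Adj w e → e ≤ u → e ≤ v → ¬ e ≤ z := fun he h1 h2 h3 =>
    ((hw.le_of_ge ⟨h1, h2, h3⟩ (h.adj_lt he).le).trans_lt (h.adj_lt he)).false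
  have key : ∀ {u v z e}, G.LeftOf k v z → G.LeftOf k z u → w ≤ u → w ≤ z → G.Adj w e → e ≤ u →
      e ≤ v → ¬ e ≤ z → False := fun {u v z e} hvz hzu hwu hwz he heu hev hez => by
    obtain ⟨d, hd, hdz⟩ := h.exists_adj_le (lt_of_le_of_ne hwz fun e => hzu.not_le (e ▸ hwu))
    rcases lt_trichotomy (k w d) (k w e) with h1 | h1 | h1
    · refine h.leftOf_asymm hk hvz ?_
      by_cases hdv : d ≤ v
      · exact h.leftOf_of_left hk hd he h1 hdv hev hdz hez hvz.not_ge
      · exact ⟨w, d, e, ⟨hd, he, hdz, hdv, hev, hez⟩, h1⟩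
    · exact hez (hk.inj hd he h1 ▸ hdz)
    · refine h.leftOf_asymm hk hzu ?_
      by_cases hdu : d ≤ u
      · exact h.leftOf_of_right hk he hd h1 heu hdu hdz hez hzu.not_le
      · exact ⟨w, e, d, ⟨he, hd, heu, hez, hdz, hdu⟩, h1⟩
  obtain ⟨e₁, he₁, hu⟩ := h.exists_adj_le (lt_of_le_of_ne hwu fun e => huv.not_le (e ▸ hwv))
  obtain ⟨e₂, he₂, hv⟩ := h.exists_adj_le (lt_of_le_of_ne hwv fun e => hvz.not_le (e ▸ hwz))
  obtain ⟨e₃, he₃, hz⟩ := h.exists_adj_le (lt_of_le_of_ne hwz fun e => hzu.not_le (e ▸ hwu))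
  have c₁ : ∀ {e}, G.Adj w e → e ≤ u → ¬ e ≤ v := fun he h1 h2 =>
    key hvz hzu hwu hwz he h1 h2 (hmax he h1 h2)
  have c₂ : ∀ {e}, G.Adj w e → e ≤ v → ¬ e ≤ z := fun he h1 h2 =>
    key hzu huv hwv hwu he h1 h2 (fun h3 => hmax he h3 h1 h2)
  have c₃ : ∀ {e}, G.Adj w e → e ≤ z → ¬ e ≤ u := fun he h1 h2 =>
    key huv hvz hwz hwv he h1 h2 (fun h3 => hmax he h2 h3 h1)
  have lt : ∀ {u v e e'}, G.LeftOf k u v → G.Separates w e e' u v → k w e < k w e' :=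
    fun huv a => (a.leftOf_or hk).resolve_right (h.leftOf_asymm hk huv)
  have l₁ := lt huv ⟨he₁, he₂, hu, c₁ he₁ hu, hv, fun h' => c₁ he₂ h' hv⟩
  have l₂ := lt hvz ⟨he₂, he₃, hv, c₂ he₂ hv, hz, fun h' => c₂ he₃ h' hz⟩
  have l₃ := lt hzu ⟨he₃, he₁, hz, c₃ he₃ hz, hu, fun h' => c₃ he₁ h' hu⟩
  omega

theorem leftOf_trans (h : G.IsRootedCactus H s) (hk : G.IsOuterplanarKey k)
    (huv : G.LeftOf k u v) (hvz : G.LeftOf k v z) : G.LeftOf k u z := by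
  have huz : ¬ u ≤ z := fun huz => by
    refine h.leftOf_asymm hk hvz ?_
    obtain ⟨w, c, d, a, hcd⟩ := huv
    by_cases hdz : d ≤ z
    · exact h.leftOf_of_right hk a.adj_left a.adj_right hcd (a.le_left.trans huz) hdz a.le_right
        a.not_le_left hvz.not_le
    · exact ⟨w, c, d, ⟨a.adj_left, a.adj_right, a.le_left.trans huz, a.not_le_left, a.le_right,
        hdz⟩, hcd⟩
  have hzu : ¬ z ≤ u := fun hzu => by
    refine h.leftOf_asymm hk huv ?_
    obtain ⟨w, c, d, a, hcd⟩ := hvz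
    by_cases hcu : c ≤ u
    · exact h.leftOf_of_left hk a.adj_left a.adj_right hcd hcu (a.le_right.trans hzu) a.le_left
        a.not_le_right huv.not_ge
    · exact ⟨w, c, d, ⟨a.adj_left, a.adj_right, a.le_left, hcu, a.le_right.trans hzu,
        a.not_le_right⟩, hcd⟩
  exact (h.leftOf_or_leftOf hk huz hzu).resolve_right fun hzu =>
    h.leftOf_not_cyclic hk huv hvz hzu

/-- The combinatorial form of planarity: in the drawing, the vertical segment of `u → v` would cross
the horizontal segment of `u' → v'`. -/
theorem not_crossing (h : G.IsRootedCactus H s) (hk : G.IsOuterplanarKey k) {u' v' : V}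
    (huv : G.Adj u v) (huv' : G.Adj u' v') (hlt : u < v') (hu : u' < u ∨ G.LeftOf k u u')
    (hv : v' < v ∨ G.LeftOf k v' v) : False := by
  obtain ⟨e, he, hev'⟩ := h.exists_adj_le hlt
  have hvv' : ¬ v ≤ v' := hv.elim (fun h' => h'.not_ge) fun h' => h'.not_ge
  -- The vertex `u` lies on the left side of a cycle through `v'`, so `u → e` is its last edge.
  have h1 : k u v < k u e := by
    rcases hu with hu | ⟨w, c, d, a, hcd⟩
    · obtain ⟨e', he', heu'⟩ := h.exists_adj_le hu
      have hne : e' ≠ v' := fun h' => ((h' ▸ heu').trans_lt hlt).false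
      exact hk.last_of_left ⟨he', huv', heu', hlt.not_ge, he, v', hev', le_rfl⟩
        (hk.lt_of_le he' huv' hne (heu'.trans hlt.le)) huv fun h' => hvv' (h' ▸ hev')
    · exact hk.last_of_left ⟨a.adj_left, a.adj_right, a.le_left, a.not_le_right, he, v', hev',
        a.le_right.trans (h.adj_lt huv').le⟩ hcd huv fun h' => hvv' (h' ▸ hev')
  -- On the other hand, `v` lies above `v'` or to its right.
  have h2 : k u e < k u v := by
    by_cases hle : e ≤ v
    · exact hk.lt_of_le he huv (fun h' => hvv' (h' ▸ hev')) hle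
    · have a : G.Separates u e v v' v := ⟨he, huv, hev', hle, le_rfl, hvv'⟩
      exact (a.leftOf_or hk).resolve_right fun hl =>
        hv.elim (fun h' => hl.not_ge h'.le) fun h' => h.leftOf_asymm hk h' hl
  exact h1.asymm h2

/-- No vertex `v` lies on the right side of a cycle, whose left side is closed by `u → z`, and on
the left side of a cycle, whose right side is closed by `u' → z'`. -/
theorem not_right_and_left (h : G.IsRootedCactus H s) (hk : G.IsOuterplanarKey k) {u' z' : V}
    (huz : G.Adj u z) (huv : G.LeftOf k u v) (hvz : v < z) (huz' : G.Adj u' z') (hvz' : v < z')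
    (huv' : u' < v ∨ G.LeftOf k v u') : False := by
  obtain ⟨f, hf, hfz⟩ := h.exists_adj_le hvz
  obtain ⟨f', hf', hfz'⟩ := h.exists_adj_le hvz'
  obtain ⟨w, c, d, a, hcd⟩ := huv
  have o : G.OnCycle w d c v f := ⟨a.adj_right, a.adj_left, a.le_right, a.not_le_left, hf, z, hfz,
    a.le_left.trans (h.adj_lt huz).le⟩
  rcases huv' with huv' | ⟨w', c', d', a', hcd'⟩
  · obtain ⟨e, he, hev⟩ := h.exists_adj_le huv'
    have o' : G.OnCycle u' e z' v f' := ⟨he, huz', hev, hvz'.not_ge, hf', z', hfz', le_rfl⟩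
    have hlt := hk.lt_of_le he huz' o'.ne (hev.trans hvz'.le)
    obtain ⟨rfl, rfl, rfl, -⟩ := o.unique o' h
    exact hcd.asymm hlt
  · have o' : G.OnCycle w' c' d' v f' := ⟨a'.adj_left, a'.adj_right, a'.le_left, a'.not_le_right,
      hf', z', hfz', a'.le_right.trans (h.adj_lt huz').le⟩
    obtain ⟨rfl, rfl, rfl, -⟩ := o.unique o' h
    exact hcd.asymm hcd'

end IsRootedCactus

end

end Digraph

/-! ### The dominance drawing -/

/-- A strict total order on a finite set is the order of coordinates `1, …, n`. -/
theorem exists_grid_coordinate {V : Type*} [Finite V] (r : V → V → Prop) (hirr : ∀ a, ¬ r a a)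
    (htrans : ∀ a b c, r a b → r b c → r a c) (htotal : ∀ a b, a ≠ b → r a b ∨ r b a) :
    ∃ f : V → ℝ, (∀ a b, f a < f b ↔ r a b) ∧
      Set.range f = (fun k : ℕ => (k : ℝ)) '' Set.Icc 1 (Nat.card V) := by
  classical
  have := Fintype.ofFinite V
  have : IsStrictTotalOrder V r :=
    { irrefl := hirr
      trans := htrans
      trichotomous := fun a b hab hba => by
        by_contra hne
        exact (htotal a b hne).elim hab hba }
  let _ : LinearOrder V := linearOrderOfSTO r
  let e : Fin (Nat.card V) ≃o V := Fintype.orderIsoFinOfCardEq V Nat.card_eq_fintype_card.symm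
  refine ⟨fun a => ((e.symm a : ℕ) + 1 : ℕ), fun a b => ?_, ?_⟩
  · rw [Nat.cast_lt, Nat.add_lt_add_iff_right, Fin.val_fin_lt, e.symm.lt_iff_lt]
    rfl
  · ext x
    simp only [Set.mem_range, Set.mem_image, Set.mem_Icc]
    constructor
    · rintro ⟨a, rfl⟩
      exact ⟨_, ⟨by omega, (e.symm a).isLt⟩, rfl⟩
    · rintro ⟨k, ⟨h1, h2⟩, rfl⟩
      refine ⟨e ⟨k - 1, by omega⟩, ?_⟩
      rw [OrderIso.symm_apply_apply]
      exact congrArg _ (Nat.sub_add_cancel h1)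

theorem mem_segment_vertical {a b c : ℝ} (hbc : b ≤ c) {z : ℝ × ℝ}
    (hz : z ∈ segment ℝ (a, b) (a, c)) : z.1 = a ∧ b ≤ z.2 ∧ z.2 ≤ c := by
  obtain ⟨s, t, hs, ht, hst, rfl⟩ := hz
  obtain rfl : s = 1 - t := by linarith
  simp only [Prod.fst_add, Prod.smul_fst, Prod.snd_add, Prod.smul_snd, smul_eq_mul]
  refine ⟨by ring, by nlinarith, by nlinarith⟩

theorem mem_openSegment_vertical {a b c : ℝ} (hbc : b < c) {z : ℝ × ℝ}
    (hz : z ∈ openSegment ℝ (a, b) (a, c)) : z.1 = a ∧ b < z.2 ∧ z.2 < c := by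
  obtain ⟨s, t, hs, ht, hst, rfl⟩ := hz
  obtain rfl : s = 1 - t := by linarith
  simp only [Prod.fst_add, Prod.smul_fst, Prod.snd_add, Prod.smul_snd, smul_eq_mul]
  refine ⟨by ring, by nlinarith, by nlinarith⟩

theorem mem_segment_horizontal {a b c : ℝ} (hac : a ≤ c) {z : ℝ × ℝ}
    (hz : z ∈ segment ℝ (c, b) (a, b)) : z.2 = b ∧ a ≤ z.1 ∧ z.1 ≤ c := by
  obtain ⟨s, t, hs, ht, hst, rfl⟩ := hz
  obtain rfl : s = 1 - t := by linarith
  simp only [Prod.fst_add, Prod.smul_fst, Prod.snd_add, Prod.smul_snd, smul_eq_mul]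
  refine ⟨by ring, by nlinarith, by nlinarith⟩

theorem mem_openSegment_horizontal {a b c : ℝ} (hac : a < c) {z : ℝ × ℝ}
    (hz : z ∈ openSegment ℝ (c, b) (a, b)) : z.2 = b ∧ a < z.1 ∧ z.1 < c := by
  obtain ⟨s, t, hs, ht, hst, rfl⟩ := hz
  obtain rfl : s = 1 - t := by linarith
  simp only [Prod.fst_add, Prod.smul_fst, Prod.snd_add, Prod.smul_snd, smul_eq_mul]
  refine ⟨by ring, by nlinarith, by nlinarith⟩

theorem not_isBounded_Iio_prod {a : ℝ} {T : Set ℝ} (hT : T.Nonempty) :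
    ¬ Bornology.IsBounded (Set.Iio a ×ˢ T) := fun hb =>
  not_bddBelow_Iio a (hb.fst_of_prod hT).bddBelow

namespace LDrawing

variable {V : Type*} {D : LDrawing V} {G : Digraph V}

theorem IsUpwardLeftward.mem_support_cases (hD : D.IsUpwardLeftward G) {z : ℝ × ℝ}
    (hz : z ∈ D.support G) : (∃ v, z = D.point v) ∨ ∃ u v, G.Adj u v ∧
      ((z.1 = D.x u ∧ D.y u ≤ z.2 ∧ z.2 ≤ D.y v) ∨
        (z.2 = D.y v ∧ D.x v ≤ z.1 ∧ z.1 ≤ D.x u)) := by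
  rcases hz with ⟨v, rfl⟩ | ⟨u, v, huv, hz | hz⟩
  · exact .inl ⟨v, rfl⟩
  · exact .inr ⟨u, v, huv, .inl (mem_segment_vertical (hD huv).1.le hz)⟩
  · exact .inr ⟨u, v, huv, .inr (mem_segment_horizontal (hD huv).2.le hz)⟩

/-- An unbounded connected set outside the drawing lies in the outer face. -/
theorem mem_closure_outerFace {S : Set (ℝ × ℝ)} (hS : IsPreconnected S)
    (hsub : ∀ z ∈ S, z ∉ D.support G) (hb : ¬ Bornology.IsBounded S) {p : ℝ × ℝ}
    (hp : p ∈ closure S) : p ∈ closure (D.outerFace G) :=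
  closure_mono (t := D.outerFace G) (fun z hz => ⟨hsub z hz, fun hb' =>
    hb (hb'.subset (hS.subset_connectedComponentIn hz hsub))⟩) hp

theorem OnGrid.eq_nat (hD : D.OnGrid) (v : V) :
    (∃ m : ℕ, D.x v = m) ∧ ∃ m : ℕ, D.y v = m := by
  have hx : D.x v ∈ Set.range D.x := ⟨v, rfl⟩
  have hy : D.y v ∈ Set.range D.y := ⟨v, rfl⟩
  rw [hD.1] at hx
  rw [hD.2] at hy
  obtain ⟨m, -, hm⟩ := hx
  obtain ⟨n, -, hn⟩ := hy
  exact ⟨⟨m, hm.symm⟩, n, hn.symm⟩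

theorem OnGrid.add_one_le_x (hD : D.OnGrid) {u v : V} (h : D.x u < D.x v) :
    D.x u + 1 ≤ D.x v := by
  obtain ⟨⟨m, hm⟩, -⟩ := hD.eq_nat u
  obtain ⟨⟨n, hn⟩, -⟩ := hD.eq_nat v
  rw [hm, hn] at h ⊢
  exact_mod_cast h

theorem OnGrid.add_one_le_y (hD : D.OnGrid) {u v : V} (h : D.y u < D.y v) :
    D.y u + 1 ≤ D.y v := by
  obtain ⟨-, m, hm⟩ := hD.eq_nat u
  obtain ⟨-, n, hn⟩ := hD.eq_nat v
  rw [hm, hn] at h ⊢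
  exact_mod_cast h

variable [PartialOrder V] {H : SimpleGraph V} {k : V → V → ℤ} {s : V}

/-- The drawing in which a vertex precedes another one from bottom to top if it is an ancestor or
to the left, and from right to left if it is an ancestor or to the right. -/
structure IsDominance (D : LDrawing V) (G : Digraph V) (k : V → V → ℤ) : Prop where
  y_lt_iff : ∀ u v, D.y u < D.y v ↔ u < v ∨ G.LeftOf k u v
  x_lt_iff : ∀ u v, D.x u < D.x v ↔ v < u ∨ G.LeftOf k u v
  onGrid : D.OnGrid

theorem exists_isDominance [Finite V] (h : G.IsRootedCactus H s) (hk : G.IsOuterplanarKey k) :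
    ∃ D : LDrawing V, D.IsDominance G k := by
  have htotal : ∀ u v : V, u ≠ v → (u < v ∨ v < u) ∨ G.LeftOf k u v ∨ G.LeftOf k v u := by
    intro u v hne
    by_cases h1 : u ≤ v
    · exact .inl (.inl (lt_of_le_of_ne h1 hne))
    by_cases h2 : v ≤ u
    · exact .inl (.inr (lt_of_le_of_ne h2 hne.symm))
    exact .inr (h.leftOf_or_leftOf hk h1 h2)
  have hirr : ∀ u : V, ¬ G.LeftOf k u u := fun u hu => hu.not_le le_rfl
  -- The transitivity of the two unions of the left-to-right order with reachability.
  have mix : ∀ {u v z : V}, G.LeftOf k u v → v < z → (u < z ∨ G.LeftOf k u z) := by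
    intro u v z huv hvz
    rcases htotal u z (fun e => huv.not_ge (e ▸ hvz.le)) with (h1 | h1) | h1 | h1
    · exact .inl h1
    · exact absurd (hvz.trans h1).le huv.not_ge
    · exact .inr h1
    · exact absurd hvz.le (h.leftOf_trans hk h1 huv).not_ge
  have mix' : ∀ {u v z : V}, u < v → G.LeftOf k v z → (u < z ∨ G.LeftOf k u z) := by
    intro u v z huv hvz
    rcases htotal u z (fun e => hvz.not_ge (e ▸ huv.le)) with (h1 | h1) | h1 | h1
    · exact .inl h1
    · exact absurd (h1.trans huv).le hvz.not_ge
    · exact .inr h1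
    · exact absurd huv.le (h.leftOf_trans hk hvz h1).not_ge
  have mix'' : ∀ {u v z : V}, G.LeftOf k u v → z < v → (z < u ∨ G.LeftOf k u z) := by
    intro u v z huv hvz
    rcases htotal u z (fun e => huv.not_le (e ▸ hvz.le)) with (h1 | h1) | h1 | h1
    · exact absurd (h1.trans hvz).le huv.not_le
    · exact .inl h1
    · exact .inr h1
    · exact absurd hvz.le (h.leftOf_trans hk h1 huv).not_le
  have mix''' : ∀ {u v z : V}, v < u → G.LeftOf k v z → (z < u ∨ G.LeftOf k u z) := by
    intro u v z huv hvz
    rcases htotal u z (fun e => hvz.not_le (e ▸ huv.le)) with (h1 | h1) | h1 | h1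
    · exact absurd (huv.trans h1).le hvz.not_le
    · exact .inl h1
    · exact .inr h1
    · exact absurd huv.le (h.leftOf_trans hk hvz h1).not_le
  obtain ⟨y, hy, hy'⟩ := exists_grid_coordinate (fun u v => u < v ∨ G.LeftOf k u v)
    (fun u hu => hu.elim (lt_irrefl u) (hirr u))
    (fun u v z huv hvz => by
      rcases huv with huv | huv <;> rcases hvz with hvz | hvz
      · exact .inl (huv.trans hvz)
      · exact mix' huv hvz
      · exact mix huv hvz
      · exact .inr (h.leftOf_trans hk huv hvz))
    (fun u v hne => by have := htotal u v hne; tauto)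
  obtain ⟨x, hx, hx'⟩ := exists_grid_coordinate (fun u v => v < u ∨ G.LeftOf k u v)
    (fun u hu => hu.elim (lt_irrefl u) (hirr u))
    (fun u v z huv hvz => by
      rcases huv with huv | huv <;> rcases hvz with hvz | hvz
      · exact .inl (hvz.trans huv)
      · exact mix''' huv hvz
      · exact mix'' huv hvz
      · exact .inr (h.leftOf_trans hk huv hvz))
    (fun u v hne => by have := htotal u v hne; tauto)
  have hinj : ∀ f : V → ℝ, (∀ u v, u ≠ v → f u < f v ∨ f v < f u) → Function.Injective f :=
    fun f hf u v huv => by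
      by_contra hne
      exact (hf u v hne).elim huv.not_lt huv.not_gt
  refine ⟨⟨x, y, hinj x fun u v hne => ?_, hinj y fun u v hne => ?_⟩, hy, hx, hx', hy'⟩
  · rw [hx, hx]; have := htotal u v hne; tauto
  · rw [hy, hy]; have := htotal u v hne; tauto

namespace IsDominance

theorem isUpwardLeftward (hD : D.IsDominance G k) (h : G.IsReachOrder H) :
    D.IsUpwardLeftward G :=
  fun u v huv => ⟨(hD.y_lt_iff u v).2 (.inl (h.adj_lt huv)),
    (hD.x_lt_iff v u).2 (.inl (h.adj_lt huv))⟩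

variable [Finite V]

theorem isPlanar (hD : D.IsDominance G k) (h : G.IsRootedCactus H s)
    (hk : G.IsOuterplanarKey k) : D.IsPlanar G := by
  intro u v u' v' huv huv'
  have hul := hD.isUpwardLeftward h.toIsReachOrder
  rw [Set.disjoint_left]
  intro z hz hz'
  obtain ⟨h1, h2, h3⟩ := mem_openSegment_vertical (hul huv).1 hz
  obtain ⟨h4, h5, h6⟩ := mem_openSegment_horizontal (hul huv').2 hz'
  rw [h4, hD.y_lt_iff] at h2 h3
  rw [h1, hD.x_lt_iff] at h5 h6
  have hlt : u < v' := h5.elim id fun h5 =>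
    h2.elim id fun h2 => (h.leftOf_asymm hk h2 h5).elim
  exact h.not_crossing hk huv huv' hlt h6 h3

/-- Every vertex can be connected with infinity either by the ray to its left or, if it is on the
right side of a cycle, by a path that runs just to its right up above its highest descendant and
from there to the left. -/
theorem isOuterplanar (hD : D.IsDominance G k) (h : G.IsRootedCactus H s)
    (hk : G.IsOuterplanarKey k) : D.IsOuterplanar G := by
  refine ⟨hD.isPlanar h hk, fun v => ?_⟩
  have hul := hD.isUpwardLeftward h.toIsReachOrder
  have hasymm : ∀ {a b}, G.LeftOf k a b → ¬ G.LeftOf k b a := fun h1 h2 =>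
    h.leftOf_asymm hk h1 h2
  by_cases hleft : ∃ u z, G.Adj u z ∧ G.LeftOf k u v ∧ v < z
  · obtain ⟨w, hvw, hw⟩ : ∃ w, v ≤ w ∧ ∀ w', v ≤ w' → D.y w' ≤ D.y w :=
      Set.exists_max_image {w | v ≤ w} D.y (Set.toFinite _) ⟨v, le_rfl⟩
    have hvw' := hw v le_rfl
    -- Coordinates are integers, so margins of one unit contain no other vertices.
    have hconv₁ := (convex_Ioo (𝕜 := ℝ) (D.x v) (D.x v + 1)).prod
      (convex_Ioo (𝕜 := ℝ) (D.y v) (D.y w + 1))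
    have hconv₂ := (convex_Iio (𝕜 := ℝ) (D.x v + 1)).prod
      (convex_Ioo (𝕜 := ℝ) (D.y w) (D.y w + 1))
    have hconn := IsPreconnected.union (D.x v + 1 / 2, D.y w + 1 / 2)
      (by exact ⟨⟨by simp, by simp; norm_num⟩, by dsimp only; linarith, by simp; norm_num⟩)
      (by exact ⟨by simp; norm_num, by simp, by simp; norm_num⟩)
      hconv₁.isPreconnected hconv₂.isPreconnected
    refine mem_closure_outerFace hconn ?_ ?_ ?_
    · rintro z hz hzD
      have hmem : z.1 < D.x v + 1 ∧ D.y v < z.2 ∧ z.2 < D.y w + 1 ∧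
          (D.x v < z.1 ∨ D.y w < z.2) := by
        rcases hz with ⟨⟨h1, h2⟩, h3, h4⟩ | ⟨h1, h3, h4⟩
        · exact ⟨h2, h3, h4, .inl h1⟩
        · exact ⟨h1, hvw'.trans_lt h3, h4, .inr h3⟩
      obtain ⟨h1, h2, h3, h4⟩ := hmem
      have hx : ∀ u, D.x u < D.x v + 1 → D.x u ≤ D.x v := fun u hu =>
        not_lt.1 fun h' => (hD.onGrid.add_one_le_x h').not_gt hu
      have hy : ∀ u, D.y u < D.y w + 1 → D.y u ≤ D.y w := fun u hu =>
        not_lt.1 fun h' => (hD.onGrid.add_one_le_y h').not_gt hu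
      -- No vertical segment separates the path from infinity.
      have hvert : ∀ u z', G.Adj u z' → D.x u < D.x v + 1 → D.y u < D.y w + 1 →
          D.y w < D.y z' → False := by
        intro u z' huz hux huy hzy
        have hvz : ¬ v ≤ z' := fun hvz => (hw z' hvz).not_gt hzy
        have hvu : ¬ v ≤ u := fun hvu => hvz (hvu.trans (h.adj_lt huz).le)
        have hux' : D.x u < D.x v := lt_of_le_of_ne (hx u hux) fun e =>
          hvu (D.x_injective e).ge
        have huv := ((hD.x_lt_iff _ _).1 hux').resolve_left fun h' => hvu h'.le
        have hvz' := ((hD.y_lt_iff _ _).1 (hvw'.trans_lt hzy)).resolve_left fun h' => hvz h'.le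
        exact (h.leftOf_trans hk huv hvz').not_le (h.adj_lt huz).le
      rcases hul.mem_support_cases hzD with ⟨u, rfl⟩ | ⟨u, z', huz, ⟨e, h5, h6⟩ | ⟨e, h5, h6⟩⟩
      · rcases h4 with h4 | h4
        · exact (hx u h1).not_gt h4
        · exact (hy u h3).not_gt h4
      · rw [e] at h1 h4
        exact hvert u z' huz h1 (h5.trans_lt h3)
          ((h4.resolve_left (hx u h1).not_gt).trans_le h6)
      · rw [e] at h2 h3 h4
        have h4' := h4.resolve_right (hy z' h3).not_gt
        have hne : z' ≠ v := fun h' => h2.ne (by rw [h'])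
        have hzv := (D.x_injective.ne hne).lt_of_le (hx z' (h5.trans_lt h1))
        have hvz : v < z' := ((hD.y_lt_iff _ _).1 h2).elim id fun h2 =>
          ((hD.x_lt_iff _ _).1 hzv).elim id fun h' => absurd h' (hasymm h2)
        obtain ⟨a, b, hab, hav, hvb⟩ := hleft
        exact h.not_right_and_left hk hab hav hvb huz hvz
          ((hD.x_lt_iff _ _).1 (h4'.trans_le h6))
    · exact fun hb => not_isBounded_Iio_prod ⟨D.y w + 1 / 2, by simp; norm_num⟩
        (hb.subset Set.subset_union_right)
    · refine closure_mono Set.subset_union_left ?_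
      rw [closure_prod_eq, closure_Ioo (by linarith), closure_Ioo (by linarith)]
      exact ⟨⟨le_rfl, by simp [point]⟩, le_rfl, by simp only [point]; linarith⟩
  · have hconv := (convex_Iio (𝕜 := ℝ) (D.x v)).prod (convex_singleton (𝕜 := ℝ) (D.y v))
    refine mem_closure_outerFace hconv.isPreconnected ?_ ?_ ?_
    · rintro z ⟨h1, h2⟩ hzD
      rw [Set.mem_Iio] at h1
      rw [Set.mem_singleton_iff] at h2
      rcases hul.mem_support_cases hzD with ⟨u, rfl⟩ | ⟨u, z', huz, ⟨e, h5, h6⟩ | ⟨e, h5, h6⟩⟩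
      · exact h1.ne (congrArg D.x (D.y_injective h2))
      · rw [e] at h1
        rw [h2] at h5 h6
        have h7 := (hul huz).2
        have hy1 : D.y u < D.y v := h5.lt_of_ne fun e' => h1.ne (congrArg D.x (D.y_injective e'))
        have hy2 : D.y v < D.y z' := h6.lt_of_ne fun e' =>
          (h7.trans h1).ne (congrArg D.x (D.y_injective e'.symm))
        have huv : G.LeftOf k u v := ((hD.y_lt_iff _ _).1 hy1).elim
          (fun h' => ((hD.x_lt_iff _ _).1 h1).elim (fun h'' => absurd h' h''.asymm) id) id
        refine hleft ⟨u, z', huz, huv, ((hD.y_lt_iff _ _).1 hy2).resolve_right fun h' => ?_⟩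
        exact (h.leftOf_trans hk huv h').not_le (h.adj_lt huz).le
      · have := D.y_injective (h2.symm.trans e)
        subst this
        exact h5.not_gt h1
    · exact not_isBounded_Iio_prod (Set.singleton_nonempty _)
    · rw [closure_prod_eq, closure_Iio, closure_singleton]
      exact ⟨le_refl (D.x v), rfl⟩

end IsDominance

end LDrawing

/-! ### Left-to-right orders of arbitrary rooted cacti -/

theorem exists_linear_extension (V : Type*) [PartialOrder V] [Finite V] :
    ∃ (n : ℕ) (N : V → ℕ), (∀ v, N v < n) ∧ Function.Injective N ∧ ∀ u v, u < v → N u < N v := by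
  have := Fintype.ofFinite V
  let _ : Fintype (LinearExtension V) := this
  let e : Fin (Nat.card V) ≃o LinearExtension V :=
    Fintype.orderIsoFinOfCardEq _ Nat.card_eq_fintype_card.symm
  have hinj : Function.Injective fun v : V => (e.symm (toLinearExtension v) : ℕ) := fun u v huv =>
    e.symm.injective (Fin.ext huv)
  refine ⟨Nat.card V, fun v => e.symm (toLinearExtension v), fun v => (e.symm _).isLt, hinj,
    fun u v huv => lt_of_le_of_ne ?_ (hinj.ne huv.ne)⟩
  exact e.symm.monotone (toLinearExtension.monotone huv.le)

namespace Digraph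

/-- Two out-neighbours of `v` with a common descendant are the two successors of `v` on a cycle with
source `v`. -/
structure Siblings {V : Type*} [PartialOrder V] (G : Digraph V) (v c d : V) : Prop where
  ne : c ≠ d
  adj_left : G.Adj v c
  adj_right : G.Adj v d
  exists_le : ∃ z, c ≤ z ∧ d ≤ z

variable {V : Type*} [PartialOrder V] {G : Digraph V} {H : SimpleGraph V} {s : V}

theorem Siblings.symm {v c d : V} (a : G.Siblings v c d) : G.Siblings v d c :=
  ⟨a.ne.symm, a.adj_right, a.adj_left, a.exists_le.imp fun _ => And.symm⟩

theorem OnCycle.siblings {r c d v f : V} (o : G.OnCycle r c d v f) (h : G.IsReachOrder H) :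
    G.Siblings r c d :=
  ⟨o.ne, o.adj_left, o.adj_right, o.exists_le.imp fun _ hz =>
    ⟨(o.le.trans (h.adj_lt o.adj).le).trans hz.1, hz.2⟩⟩

variable [Finite V]

theorem Siblings.unique {v c d d' : V} (a : G.Siblings v c d) (b : G.Siblings v c d')
    (h : G.IsRootedCactus H s) : d = d' := by
  by_contra hne
  obtain ⟨z, hz, hz'⟩ := a.exists_le
  obtain ⟨y, hy, hy'⟩ := b.exists_le
  exact h.not_three a.adj_right b.adj_right a.adj_left hne a.ne.symm b.ne.symm hz' hz hy' hy

/-- Orient every cycle such that its first vertices are ordered by a linear extension of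
reachability. Then order the edges at each vertex by that linear extension, except that the second
edge of a cycle directly follows the first one, and that an edge at an inner vertex of a cycle is
moved to the side prescribed by the cycle. -/
theorem IsRootedCactus.exists_isOuterplanarKey (h : G.IsRootedCactus H s) :
    ∃ k, G.IsOuterplanarKey k := by
  classical
  obtain ⟨n, N, hn, hinj, hmono⟩ := exists_linear_extension V
  -- `L v f` (`R v f`): the edge from `v` to `f` is in the left (right) side of a cycle, and `v` is
  -- an inner vertex of that side.
  let L : V → V → Prop := fun v f => ∃ r c d, G.OnCycle r c d v f ∧ N c < N d
  let R : V → V → Prop := fun v f => ∃ r c d, G.OnCycle r c d v f ∧ N d < N c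
  have hLR : ∀ {v f g}, L v f → R v g → False := by
    rintro v f g ⟨r, c, d, o, hlt⟩ ⟨r', c', d', o', hlt'⟩
    obtain ⟨rfl, rfl, rfl, -⟩ := o.unique o' h
    exact hlt.asymm hlt'
  have hL : ∀ {v f g}, L v f → L v g → f = g := by
    rintro v f g ⟨r, c, d, o, -⟩ ⟨r', c', d', o', -⟩
    exact (o.unique o' h).2.2.2
  have hR : ∀ {v f g}, R v f → R v g → f = g := by
    rintro v f g ⟨r, c, d, o, -⟩ ⟨r', c', d', o', -⟩
    exact (o.unique o' h).2.2.2
  -- The second edge of a cycle gets the odd key after the even key of the first one.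
  have spec : ∀ v f, ∃ i : ℤ, (L v f ∧ i = 2 * n + 1) ∨ (¬ L v f ∧ R v f ∧ i = -1) ∨
      (¬ L v f ∧ ¬ R v f ∧ ∃ d, G.Siblings v f d ∧ N d < N f ∧ i = 2 * N d + 1) ∨
      (¬ L v f ∧ ¬ R v f ∧ (∀ d, G.Siblings v f d → N f < N d) ∧ i = 2 * N f) := by
    intro v f
    by_cases h1 : L v f
    · exact ⟨_, .inl ⟨h1, rfl⟩⟩
    by_cases h2 : R v f
    · exact ⟨_, .inr (.inl ⟨h1, h2, rfl⟩)⟩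
    by_cases h3 : ∃ d, G.Siblings v f d ∧ N d < N f
    · obtain ⟨d, h3, h4⟩ := h3
      exact ⟨_, .inr (.inr (.inl ⟨h1, h2, d, h3, h4, rfl⟩))⟩
    · push Not at h3
      exact ⟨_, .inr (.inr (.inr ⟨h1, h2, fun d hd => (h3 d hd).lt_of_ne (hinj.ne hd.ne), rfl⟩))⟩
  choose k hk using spec
  have hsib : ∀ {r c d}, G.Siblings r c d → N c < N d → k r c = 2 * N c ∧ k r d = 2 * N c + 1 := by
    intro r c d a hlt
    have hnot : ∀ {c d}, G.Siblings r c d → ¬ L r c ∧ ¬ R r c := fun a => by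
      obtain ⟨z, hz, hz'⟩ := a.exists_le
      exact ⟨fun ⟨_, _, _, o, _⟩ => o.not_sibling h a.adj_right a.ne hz hz',
        fun ⟨_, _, _, o, _⟩ => o.not_sibling h a.adj_right a.ne hz hz'⟩
    constructor
    · rcases hk r c with h1 | h1 | ⟨-, -, e, h1, h2, -⟩ | h1
      · exact absurd h1.1 (hnot a).1
      · exact absurd h1.2.1 (hnot a).2
      · obtain rfl := a.unique h1 h
        exact absurd hlt h2.asymm
      · exact h1.2.2.2
    · rcases hk r d with h1 | h1 | ⟨-, -, e, h1, h2, h3⟩ | h1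
      · exact absurd h1.1 (hnot a.symm).1
      · exact absurd h1.2.1 (hnot a.symm).2
      · obtain rfl := a.symm.unique h1 h
        exact h3
      · exact absurd hlt (h1.2.2.1 c a.symm).asymm
  have hsib' : ∀ {r c d}, G.Siblings r c d → k r c < k r d → N c < N d := by
    intro r c d a hlt
    by_contra hle
    have := hsib a.symm ((not_lt.1 hle).lt_of_ne (hinj.ne a.ne.symm))
    omega
  have hlt : ∀ {v f}, ¬ L v f → k v f < 2 * n + 1 := by
    intro v f hvf
    have := hn f
    rcases hk v f with h1 | h1 | ⟨-, -, e, h1, h2, h3⟩ | h1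
    · exact absurd h1.1 hvf
    · omega
    · omega
    · omega
  have hgt : ∀ {v f}, ¬ R v f → -1 < k v f := by
    intro v f hvf
    rcases hk v f with h1 | h1 | ⟨-, -, e, h1, h2, h3⟩ | h1
    · omega
    · exact absurd h1.2.1 hvf
    · omega
    · omega
  have hkL : ∀ {v f}, L v f → k v f = 2 * n + 1 := fun {v f} hvf => by
    rcases hk v f with h1 | h1 | h1 | h1
    · exact h1.2
    · exact absurd hvf h1.1
    · exact absurd hvf h1.1
    · exact absurd hvf h1.1
  have hkR : ∀ {v f}, R v f → k v f = -1 := fun {v f} hvf => by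
    rcases hk v f with h1 | h1 | h1 | h1
    · exact (hLR h1.1 hvf).elim
    · exact h1.2.2
    · exact absurd hvf h1.2.1
    · exact absurd hvf h1.2.1
  refine ⟨k, ⟨?_, ?_, ?_, ?_, ?_⟩⟩
  · intro v c d hc hd heq
    by_cases h1 : L v c
    · by_cases h2 : L v d
      · exact hL h1 h2
      · have := hkL h1; have := hlt h2; omega
    by_cases h2 : L v d
    · have := hkL h2; have := hlt h1; omega
    by_cases h3 : R v c
    · by_cases h4 : R v d
      · exact hR h3 h4
      · have := hkR h3; have := hgt h4; omega
    by_cases h4 : R v d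
    · have := hkR h4; have := hgt h3; omega
    rcases hk v c with h5 | h5 | ⟨-, -, e, h5, h6, h7⟩ | h5
    · exact absurd h5.1 h1
    · exact absurd h5.2.1 h3
    · rcases hk v d with h8 | h8 | ⟨-, -, e', h8, h9, h10⟩ | h8
      · exact absurd h8.1 h2
      · exact absurd h8.2.1 h4
      · obtain rfl : e = e' := hinj (by omega)
        exact h5.symm.unique h8.symm h
      · omega
    · rcases hk v d with h8 | h8 | ⟨-, -, e', h8, h9, h10⟩ | h8
      · exact absurd h8.1 h2
      · exact absurd h8.2.1 h4
      · omega
      · exact hinj (by omega)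
  · intro r c d e z hc hd he hcz hdz hce hed
    have a : G.Siblings r c d := ⟨fun hcd => (hcd ▸ hce.trans hed).false, hc, hd, z, hcz, hdz⟩
    have := hsib a (hsib' a (hce.trans hed))
    omega
  · intro r c d v f g o hcd hg hgf
    have hf : L v f := ⟨r, c, d, o, hsib' (o.siblings h.toIsReachOrder) hcd⟩
    rw [hkL hf]
    exact hlt fun hg => hgf (hL hg hf)
  · intro r c d v f g o hcd hg hgf
    have hf : R v f := ⟨r, c, d, o, hsib' (o.siblings h.toIsReachOrder).symm hcd⟩
    rw [hkR hf]
    exact hgt fun hg => hgf (hR hg hf)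
  · intro r c d hc hd hne hcd
    have := hsib ⟨hne, hc, hd, d, hcd, le_rfl⟩ (hmono _ _ (lt_of_le_of_ne hcd hne))
    omega

end Digraph

/-! ### Face potentials -/

namespace SimpleGraph

variable {V : Type*} {H : SimpleGraph V} {rot : Equiv.Perm H.Dart}

theorem facePerm_apply (d : H.Dart) : facePerm rot d = rot⁻¹ d.symm := rfl

theorem facePerm_symm_rot (d : H.Dart) : facePerm rot (rot d).symm = d := by
  rw [facePerm_apply, Dart.symm_symm]
  exact rot.symm_apply_apply d

instance [Finite V] : Finite H.Dart :=
  Finite.of_injective Dart.toProd fun _ _ => Dart.ext _ _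

theorem exists_dart_of_edge (e : H.edgeSet) : ∃ d : H.Dart, d.edge = e := by
  obtain ⟨e, he⟩ := e
  induction e with
  | _ u v => exact ⟨⟨(u, v), he⟩, rfl⟩

variable (H) in
/-- An arbitrary orientation of the edges. -/
noncomputable def edgeDart (e : H.edgeSet) : H.Dart := (exists_dart_of_edge e).choose

theorem edge_edgeDart (e : H.edgeSet) : (H.edgeDart e).edge = e :=
  (exists_dart_of_edge e).choose_spec

theorem eq_edgeDart_or (d : H.Dart) :
    d = H.edgeDart ⟨d.edge, d.edge_mem⟩ ∨ d = (H.edgeDart ⟨d.edge, d.edge_mem⟩).symm := by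
  have := edge_edgeDart (⟨d.edge, d.edge_mem⟩ : H.edgeSet)
  rw [dart_edge_eq_iff] at this
  rcases this with h | h
  · exact .inl h.symm
  · exact .inr (by rw [h, Dart.symm_symm])

theorem sum_darts [Fintype H.Dart] [Fintype H.edgeSet] (g : H.Dart → ℚ) :
    ∑ d, g d = ∑ e, (g (H.edgeDart e) + g (H.edgeDart e).symm) := by
  classical
  rw [← Finset.sum_fiberwise (s := Finset.univ) (g := fun d : H.Dart =>
    (⟨d.edge, d.edge_mem⟩ : H.edgeSet)) (f := g)]
  refine Finset.sum_congr rfl fun e _ => ?_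
  have : Finset.univ.filter (fun d : H.Dart => (⟨d.edge, d.edge_mem⟩ : H.edgeSet) = e) =
      {H.edgeDart e, (H.edgeDart e).symm} := by
    ext d
    simp only [Finset.mem_filter, Finset.mem_univ, true_and, Finset.mem_insert,
      Finset.mem_singleton]
    rw [← dart_edge_eq_iff, edge_edgeDart, Subtype.ext_iff]
  rw [this, Finset.sum_pair (Dart.symm_ne _).symm]

open scoped Classical in
/-- The incidence matrix of the orientation `edgeDart`. -/
noncomputable def gradMatrix (H : SimpleGraph V) : Matrix H.edgeSet V ℚ := fun e v =>
  (if (H.edgeDart e).fst = v then 1 else 0) - (if (H.edgeDart e).snd = v then 1 else 0)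

theorem gradMatrix_mulVec [Fintype V] (g : V → ℚ) (e : H.edgeSet) :
    (gradMatrix H).mulVec g e = g (H.edgeDart e).fst - g (H.edgeDart e).snd := by
  classical
  simp [Matrix.mulVec, dotProduct, gradMatrix, sub_mul, Finset.sum_sub_distrib]

open scoped Classical in
theorem transpose_gradMatrix_mulVec [Fintype H.Dart] [Fintype H.edgeSet] {a : H.Dart → ℚ}
    (ha : ∀ d, a d.symm = -a d) (v : V) :
    (gradMatrix H).transpose.mulVec (fun e => a (H.edgeDart e)) v =
      ∑ d : H.Dart, if d.fst = v then a d else 0 := by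
  rw [sum_darts]
  simp only [Matrix.mulVec, dotProduct, Matrix.transpose_apply, gradMatrix]
  refine Finset.sum_congr rfl fun e _ => ?_
  rw [ha]
  have h1 : (H.edgeDart e).symm.fst = (H.edgeDart e).snd := rfl
  simp only [h1]
  by_cases h2 : (H.edgeDart e).fst = v <;> by_cases h3 : (H.edgeDart e).snd = v <;> simp [h2, h3]

/-- By connectedness, a potential with zero gradient is constant. -/
theorem finrank_ker_gradMatrix [Fintype V] (hH : H.Connected) :
    Module.finrank ℚ (LinearMap.ker (gradMatrix H).mulVecLin) ≤ 1 := by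
  refine (Submodule.finrank_mono (t := Submodule.span ℚ {fun _ => (1 : ℚ)}) ?_).trans
    (by simpa using finrank_span_le_card (R := ℚ) {fun _ => (1 : ℚ)})
  intro g hg
  have hg' : ∀ e, g (H.edgeDart e).fst = g (H.edgeDart e).snd := fun e => by
    rw [← sub_eq_zero, ← gradMatrix_mulVec]
    exact congrFun hg e
  have hadj : ∀ u v, H.Adj u v → g u = g v := fun u v huv => by
    have h1 := hg' ⟨s(u, v), huv⟩
    rcases eq_edgeDart_or (⟨(u, v), huv⟩ : H.Dart) with h | h
    · rw [← show _ = H.edgeDart ⟨s(u, v), huv⟩ from h] at h1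
      exact h1
    · have h2 := congrArg Dart.symm h
      rw [Dart.symm_symm] at h2
      rw [← show _ = H.edgeDart ⟨s(u, v), huv⟩ from h2] at h1
      exact h1.symm
  obtain ⟨v₀⟩ := hH.nonempty
  have hconst : ∀ v, g v = g v₀ := fun v => by
    obtain ⟨p⟩ := hH.preconnected v v₀
    induction p with
    | nil => rfl
    | cons huv _ ih => rw [hadj _ _ huv, ih]
  exact Submodule.mem_span_singleton.2 ⟨g v₀, by ext v; simp [hconst v]⟩

end SimpleGraph

namespace PlaneEmbedding

open SimpleGraph

variable {V : Type*} {H : SimpleGraph V} (P : PlaneEmbedding H)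

/-- The set of faces. -/
abbrev Face : Type _ := Quotient (Equiv.Perm.SameCycle.setoid (facePerm P.rot))

/-- The face to the left of a dart. -/
def face (d : H.Dart) : P.Face := Quotient.mk _ d

theorem face_facePerm (d : H.Dart) : P.face (facePerm P.rot d) = P.face d :=
  Quotient.sound (Equiv.Perm.SameCycle.refl _ _ |>.apply_left)

/-- The coboundary of a function on the faces. -/
noncomputable def coboundary : (P.Face → ℚ) →ₗ[ℚ] (H.edgeSet → ℚ) where
  toFun φ e := φ (P.face (H.edgeDart e)) - φ (P.face (H.edgeDart e).symm)
  map_add' φ ψ := by ext e; simp; ring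
  map_smul' c φ := by ext e; simp; ring

theorem rot_induction [Finite V] {p : H.Dart → Prop} {d e : H.Dart} (hde : d.fst = e.fst)
    (hd : p d) (hrot : ∀ d', d'.fst = d.fst → p d' → p (P.rot d')) : p e := by
  obtain ⟨n, rfl⟩ := (P.rot_cyclic d e hde).exists_nat_pow_eq
  clear hde
  suffices ((P.rot ^ n) d).fst = d.fst ∧ p ((P.rot ^ n) d) from this.2
  induction n with
  | zero => exact ⟨rfl, hd⟩
  | succ n ih =>
    rw [pow_succ', Equiv.Perm.mul_apply, P.rot_fst]
    exact ⟨ih.1, hrot _ ih.1 ih.2⟩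

/-- A function on the darts that is constant around each vertex and along each edge is constant. -/
theorem const_of_rot_of_symm [Finite V] {α : Type*} (hH : H.Connected) {φ : H.Dart → α}
    (hrot : ∀ d, φ (P.rot d) = φ d) (hsymm : ∀ d, φ d.symm = φ d) (d e : H.Dart) :
    φ d = φ e := by
  have hcycle : ∀ {d e : H.Dart}, d.fst = e.fst → φ d = φ e := fun {d e} hde =>
    P.rot_induction (p := fun e => φ d = φ e) hde rfl fun e _ he => he.trans (hrot e).symm
  obtain ⟨p⟩ := hH.preconnected d.fst e.fst
  generalize hu : d.fst = u at p
  generalize hv : e.fst = v at p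
  induction p generalizing d with
  | nil => exact hcycle (hu.trans hv.symm)
  | @cons u w v huw p ih =>
    let a : H.Dart := ⟨(u, w), huw⟩
    calc φ d = φ a := hcycle hu
      _ = φ a.symm := (hsymm a).symm
      _ = φ e := ih a.symm rfl hv

theorem finrank_ker_coboundary [Finite V] (hH : H.Connected) :
    Module.finrank ℚ (LinearMap.ker P.coboundary) ≤ 1 := by
  refine (Submodule.finrank_mono (t := Submodule.span ℚ {fun _ => (1 : ℚ)}) ?_).trans
    (by simpa using finrank_span_le_card (R := ℚ) {fun _ => (1 : ℚ)})
  intro φ hφ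
  have hsymm : ∀ d, φ (P.face d.symm) = φ (P.face d) := fun d => by
    have h1 : φ (P.face _) - φ (P.face _) = 0 := congrFun hφ ⟨d.edge, d.edge_mem⟩
    rw [sub_eq_zero] at h1
    rcases eq_edgeDart_or d with h | h
    · rw [← h] at h1
      exact h1.symm
    · have h2 := congrArg Dart.symm h
      rw [Dart.symm_symm] at h2
      rw [← h2, Dart.symm_symm] at h1
      exact h1
  have hrot : ∀ d, φ (P.face (P.rot d)) = φ (P.face d) := fun d => by
    rw [← hsymm, ← P.face_facePerm, facePerm_symm_rot]
  have hconst := P.const_of_rot_of_symm (φ := fun d => φ (P.face d)) hH hrot hsymm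
  rcases isEmpty_or_nonempty H.Dart with h | ⟨⟨d⟩⟩
  · have : IsEmpty P.Face := ⟨fun f => Quotient.inductionOn f h.elim⟩
    rw [Subsingleton.elim φ 0]
    exact Submodule.zero_mem _
  · refine Submodule.mem_span_singleton.2 ⟨φ (P.face d), ?_⟩
    ext f
    induction f using Quotient.inductionOn with
    | _ e =>
      rw [Pi.smul_apply, smul_eq_mul, mul_one]
      exact hconst d e

/-- In a plane embedding every circulation is the coboundary of a function on the faces: by Euler's
formula, both spaces have the same dimension. For a cycle, this function is the winding number. -/
theorem exists_face_potential [Finite V] (hH : H.Connected) {a : H.Dart → ℚ}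
    (ha : ∀ d, a d.symm = -a d)
    (hdiv : ∀ v, ∑ᶠ d ∈ {d : H.Dart | d.fst = v}, a d = 0) :
    ∃ φ : P.Face → ℚ, ∀ d, φ (P.face d) - φ (P.face d.symm) = a d := by
  classical
  have := Fintype.ofFinite V
  have := Fintype.ofFinite H.Dart
  have := Fintype.ofFinite H.edgeSet
  have := Fintype.ofFinite P.Face
  rcases isEmpty_or_nonempty H.Dart with h | h
  · exact ⟨0, fun d => h.elim d⟩
  have hker : ∀ b : H.Dart → ℚ, (∀ d, b d.symm = -b d) →
      (∀ v, ∑ d : H.Dart, (if d.fst = v then b d else 0) = 0) →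
      (fun e => b (H.edgeDart e)) ∈ LinearMap.ker (gradMatrix H).transpose.mulVecLin := by
    intro b hb hb'
    rw [LinearMap.mem_ker]
    ext v
    rw [Matrix.mulVecLin_apply, transpose_gradMatrix_mulVec hb, hb']
    rfl
  have hle : LinearMap.range P.coboundary ≤ LinearMap.ker (gradMatrix H).transpose.mulVecLin := by
    rintro _ ⟨φ, rfl⟩
    refine hker (fun d => φ (P.face d) - φ (P.face d.symm)) (fun d => ?_) fun v => ?_
    · rw [Dart.symm_symm]; ring
    · have h1 : ∀ d : H.Dart, (if d.fst = v then φ (P.face d) - φ (P.face d.symm) else 0) =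
          (if d.fst = v then φ (P.face d) else 0) -
            (if (P.rot⁻¹ d).fst = v then φ (P.face (P.rot⁻¹ d)) else 0) := fun d => by
        have h2 : (P.rot⁻¹ d).fst = d.fst := by
          rw [← P.rot_fst, show P.rot (P.rot⁻¹ d) = d from P.rot.apply_symm_apply d]
        rw [h2, ← P.face_facePerm d.symm, facePerm_apply, Dart.symm_symm]
        split_ifs <;> simp
      rw [Finset.sum_congr rfl fun d _ => h1 d, Finset.sum_sub_distrib, sub_eq_zero]
      exact (Equiv.sum_comp P.rot⁻¹ fun d => if d.fst = v then φ (P.face d) else 0).symm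
  have heq : LinearMap.range P.coboundary = LinearMap.ker (gradMatrix H).transpose.mulVecLin := by
    refine Submodule.eq_of_le_of_finrank_le hle ?_
    have h1 := LinearMap.finrank_range_add_finrank_ker P.coboundary
    have h2 := LinearMap.finrank_range_add_finrank_ker (gradMatrix H).mulVecLin
    have h3 := LinearMap.finrank_range_add_finrank_ker (gradMatrix H).transpose.mulVecLin
    have h4 := (gradMatrix H).rank_transpose
    have h5 := P.finrank_ker_coboundary hH
    have h6 := finrank_ker_gradMatrix hH
    -- With `f` faces, `m` edges and `n` vertices, the left space has dimension at least `f - 1`,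
    -- and the right one has dimension at most `m - (n - 1)`.
    have h7 := P.euler
    have h8 : 0 < Nat.card P.Face := Nat.card_pos_iff.2 ⟨h.map P.face, inferInstance⟩
    rw [numFaces, max_eq_right (by exact h8)] at h7
    change Nat.card V + Nat.card P.Face = Nat.card H.edgeSet + 2 at h7
    simp only [Module.finrank_fintype_fun_eq_card, Nat.card_eq_fintype_card, Matrix.rank]
      at h1 h2 h3 h4 h7
    omega
  have hmem := hker a ha fun v => by
    rw [← Finset.sum_filter, ← hdiv v, finsum_mem_eq_finite_toFinset_sum _ (Set.toFinite _)]
    exact Finset.sum_congr (by ext; simp) fun _ _ => rfl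
  rw [← heq] at hmem
  obtain ⟨φ, hφ⟩ := hmem
  refine ⟨φ, fun d => ?_⟩
  have h1 : φ (P.face _) - φ (P.face _) = _ := congrFun hφ ⟨d.edge, d.edge_mem⟩
  rcases eq_edgeDart_or d with h | h
  · rw [← h] at h1
    exact h1
  · have h2 := congrArg Dart.symm h
    rw [Dart.symm_symm] at h2
    rw [← h2, Dart.symm_symm, ha] at h1
    linarith

end PlaneEmbedding

/-! ### Inner darts of an outerplanar cactus -/

namespace SimpleGraph

variable {V : Type*} {H : SimpleGraph V}

/-- A cycle of a cactus has no chords. -/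
theorem IsCactus.mem_edges_of_adj (hH : H.IsCactus) {w : V} {C : H.Walk w w} (hC : C.IsCycle)
    {u v : V} (hu : u ∈ C.support) (hv : v ∈ C.support) (huv : H.Adj u v) :
    s(u, v) ∈ C.edges := by
  classical
  have hC' := hC.rotate hv
  have hu' := (C.mem_support_rotate_iff v hv).2 hu
  let p := (C.rotate v hv).takeUntil u hu'
  have hp : ∀ e ∈ p.edges, e ∈ C.edges := fun e he =>
    (C.rotate_edges v hv).perm.subset (Walk.edges_takeUntil_subset_edges _ _ he)
  by_contra hmem
  have hcyc : (Walk.cons huv p).IsCycle :=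
    (Walk.cons_isCycle_iff p huv).2 ⟨hC'.isPath_takeUntil hu', fun h => hmem (hp _ h)⟩
  have hedge := Walk.mk_start_snd_mem_edges (p := p) (Walk.not_nil_of_ne huv.ne.symm)
  have hsub := hH.2 _ C hcyc hC _ (by rw [Walk.edges_cons]; exact List.mem_cons_of_mem _ hedge)
    (hp _ hedge)
  rw [← Walk.mem_edges_toSubgraph, ← hsub, Walk.mem_edges_toSubgraph] at hmem
  exact hmem (by simp)

theorem Walk.IsCycle.exists_ne_dart {w : V} {C : H.Walk w w} (hC : C.IsCycle) {d : H.Dart}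
    (hd : d.edge ∈ C.edges) : ∃ e : H.Dart, e.fst = d.fst ∧ e.edge ∈ C.edges ∧ e ≠ d := by
  have hcard := hC.ncard_neighborSet_toSubgraph_eq_two (C.fst_mem_support_of_mem_edges hd)
  obtain ⟨x, hx, hne⟩ := Set.exists_ne_of_one_lt_ncard (by omega :
    1 < (C.toSubgraph.neighborSet d.fst).ncard) d.snd
  refine ⟨⟨(d.fst, x), C.toSubgraph.adj_sub hx⟩, rfl, Walk.mem_edges_toSubgraph C |>.1 hx, ?_⟩
  exact fun h => hne (congrArg (fun e : H.Dart => e.snd) h)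

theorem Walk.IsCycle.eq_or_eq_dart {w : V} {C : H.Walk w w} (hC : C.IsCycle) {d e f : H.Dart}
    (hd : d.edge ∈ C.edges) (he : e.edge ∈ C.edges) (hf : f.edge ∈ C.edges)
    (hed : e.fst = d.fst) (hfd : f.fst = d.fst) (hne : e ≠ d) : f = d ∨ f = e := by
  have hcard := hC.ncard_neighborSet_toSubgraph_eq_two (C.fst_mem_support_of_mem_edges hd)
  have hmem : ∀ {g : H.Dart}, g.edge ∈ C.edges → g.fst = d.fst →
      g.snd ∈ C.toSubgraph.neighborSet d.fst := fun {g} hg hgd => by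
    rw [Subgraph.mem_neighborSet, ← hgd, ← Subgraph.mem_edgeSet, Walk.mem_edges_toSubgraph]
    exact hg
  have hext : ∀ {g g' : H.Dart}, g.fst = d.fst → g'.fst = d.fst → g.snd = g'.snd → g = g' :=
    fun h1 h2 h3 => Dart.ext _ _ (Prod.ext (h1.trans h2.symm) h3)
  by_contra hcon
  push Not at hcon
  have hlt := (Set.two_lt_ncard (Set.finite_of_ncard_pos (by omega))).2
    ⟨_, hmem hd rfl, _, hmem he hed, _, hmem hf hfd, fun h => hne (hext hed rfl h.symm),
      fun h => hcon.1 (hext hfd rfl h.symm), fun h => hcon.2 (hext hfd hed h.symm)⟩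
  omega

open scoped Classical in
/-- The circulation along a walk. -/
noncomputable def Walk.circulation {u v : V} (p : H.Walk u v) (d : H.Dart) : ℚ :=
  p.darts.count d - p.darts.count d.symm

theorem Walk.circulation_symm {u v : V} (p : H.Walk u v) (d : H.Dart) :
    p.circulation d.symm = -p.circulation d := by
  simp [circulation]

open scoped Classical in
theorem Walk.sum_circulation [Fintype H.Dart] {u v : V} (p : H.Walk u v) (x : V) :
    (∑ d : H.Dart, if d.fst = x then p.circulation d else 0) =
      (if u = x then 1 else 0) - (if v = x then 1 else 0) := by
  induction p with
  | nil => simp [circulation]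
  | @cons u w v huw p ih =>
    let a : H.Dart := ⟨(u, w), huw⟩
    have h1 : ∀ d : H.Dart, (if d.fst = x then (cons huw p).circulation d else 0) =
        (if d.fst = x then p.circulation d else 0) +
          ((if a = d then (if a.fst = x then 1 else 0) else 0) -
            (if a.symm = d then (if a.snd = x then 1 else 0) else 0)) := fun d => by
      have h2 : (a = d.symm) = (a.symm = d) :=
        propext ⟨fun h => by rw [h, Dart.symm_symm], fun h => by rw [← h, Dart.symm_symm]⟩
      have h3 : (cons huw p).circulation d =
          p.circulation d + ((if a = d then 1 else 0) - (if a.symm = d then 1 else 0)) := by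
        simp only [circulation, darts_cons, List.count_cons, ← h2]
        simp only [beq_iff_eq]
        push_cast
        ring
      rw [h3]
      by_cases h4 : a = d
      · subst h4
        simp only [if_true, if_neg (Dart.symm_ne a)]
        split_ifs <;> simp
      · by_cases h5 : a.symm = d
        · subst h5
          have h6 : a.symm.fst = a.snd := rfl
          rw [h6]
          split_ifs <;> simp
        · simp [h4, h5]
    rw [Finset.sum_congr rfl fun d _ => h1 d, Finset.sum_add_distrib, ih, Finset.sum_sub_distrib,
      Finset.sum_ite_eq, Finset.sum_ite_eq]
    simp only [Finset.mem_univ, if_true, a]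
    ring

theorem Walk.circulation_eq_zero {u v : V} {p : H.Walk u v} {d : H.Dart} (hd : d.edge ∉ p.edges) :
    p.circulation d = 0 := by
  classical
  have h1 : d ∉ p.darts := fun h => hd (List.mem_map_of_mem h)
  have h2 : d.symm ∉ p.darts := fun h => hd (d.edge_symm ▸ List.mem_map_of_mem h)
  simp [circulation, List.count_eq_zero_of_not_mem h1, List.count_eq_zero_of_not_mem h2]

theorem Walk.IsTrail.circulation_ne_zero {u v : V} {p : H.Walk u v} (hp : p.IsTrail) {d : H.Dart}
    (hd : d.edge ∈ p.edges) : p.circulation d ≠ 0 := by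
  classical
  have hnodup := hp.edges_nodup
  have hinj := List.inj_on_of_nodup_map hnodup
  have hdarts := List.Nodup.of_map _ hnodup
  have key : ∀ d ∈ p.darts, p.circulation d = 1 := fun d hd => by
    have h2 : d.symm ∉ p.darts := fun h => Dart.symm_ne d (hinj h hd d.edge_symm)
    simp [circulation, List.count_eq_one_of_mem hdarts hd, List.count_eq_zero_of_not_mem h2]
  obtain ⟨e, he, hed⟩ := List.mem_map.1 hd
  rcases (dart_edge_eq_iff _ _).1 hed with rfl | rfl
  · rw [key _ he]; exact one_ne_zero
  · have := key _ he
    rw [circulation_symm] at this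
    intro h
    rw [h] at this
    norm_num at this

end SimpleGraph

namespace PlaneEmbedding

open SimpleGraph

variable {V : Type*} [Finite V] {H : SimpleGraph V} (P : PlaneEmbedding H)

/-- Every cycle `C` of an outerplanar embedding of a cactus bounds a set `I` of darts, those with
nonzero winding number: it is disjoint from the outer face and contains exactly one dart of every
edge of `C`, and no other darts. -/
theorem exists_inner_of_isCycle (hH : H.IsCactus) (hP : P.IsOuterplanar) {w : V} {C : H.Walk w w}
    (hC : C.IsCycle) : ∃ I : Set H.Dart, (∀ d ∈ I, facePerm P.rot d ∈ I) ∧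
      (∀ d, facePerm P.rot d ∈ I → d ∈ I) ∧ (∀ d ∈ I, d ∉ P.outer) ∧
      (∀ d ∈ I, d.edge ∈ C.edges) ∧ ∀ d : H.Dart, d.edge ∈ C.edges → (d ∈ I ↔ d.symm ∉ I) := by
  classical
  have := Fintype.ofFinite H.Dart
  have hdart : Nonempty H.Dart := by
    cases C with
    | nil => exact absurd rfl hC.ne_nil
    | cons h _ => exact ⟨⟨(_, _), h⟩⟩
  obtain ⟨φ, hφ⟩ := P.exists_face_potential hH.1 C.circulation_symm fun v => by
    rw [finsum_mem_eq_finite_toFinset_sum _ (Set.toFinite _)]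
    have := C.sum_circulation v
    rw [sub_self, ← Finset.sum_filter] at this
    rw [← this]
    exact Finset.sum_congr (by ext; simp) fun _ _ => rfl
  obtain ⟨d₀, hd₀⟩ := P.outer_face.resolve_right (not_isEmpty_iff.2 hdart)
  have hout : ∀ d ∈ P.outer, φ (P.face d) = φ (P.face d₀) := fun d hd => by
    rw [hd₀] at hd
    exact congrArg φ (Quotient.sound hd).symm
  have hvert : ∀ v, ∃ d ∈ P.outer, d.fst = v := hP.resolve_right (not_isEmpty_iff.2 hdart)
  -- The winding number around the face to the left of a dart, which vanishes on the outer face.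
  let ψ : H.Dart → ℚ := fun d => φ (P.face d) - φ (P.face d₀)
  have hψ : ∀ d, ψ d - ψ d.symm = C.circulation d := fun d => by
    rw [← hφ d]; ring
  have hψout : ∀ d ∈ P.outer, ψ d = 0 := fun d hd => sub_eq_zero.2 (hout d hd)
  have hψface : ∀ d, ψ (facePerm P.rot d) = ψ d := fun d => by
    simp only [ψ, P.face_facePerm]
  have hψrot : ∀ d, ψ (P.rot d).symm = ψ d := fun d => by
    rw [← hψface, facePerm_symm_rot]
  -- Around a vertex outside `C` the winding number is constant, and it vanishes at the outer face.
  have hsupp : ∀ d : H.Dart, ψ d ≠ 0 → d.fst ∈ C.support := by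
    intro d hd
    by_contra hv
    obtain ⟨e, he, hed⟩ := hvert d.fst
    refine P.rot_induction (p := fun e => ψ e ≠ 0) hed.symm hd (fun e he hne => ?_) (hψout e he)
    have hzero : C.circulation (P.rot e) = 0 := Walk.circulation_eq_zero fun hmem =>
      hv (he ▸ P.rot_fst e ▸ C.fst_mem_support_of_mem_edges hmem)
    rw [← hψ, hψrot, sub_eq_zero] at hzero
    rwa [hzero]
  have hedge : ∀ d : H.Dart, ψ d ≠ 0 → d.edge ∈ C.edges := by
    intro d hd
    by_contra hmem
    have hzero := Walk.circulation_eq_zero hmem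
    rw [← hψ, sub_eq_zero] at hzero
    exact hmem (hH.mem_edges_of_adj hC (hsupp d hd) (hsupp d.symm (hzero ▸ hd)) d.adj)
  refine ⟨{d | ψ d ≠ 0}, fun d hd => ?_, fun d hd => ?_, fun d hd hdo => hd (hψout d hdo), hedge,
    fun d hd => ?_⟩
  · rw [Set.mem_ofPred_eq, hψface]; exact hd
  · rw [Set.mem_ofPred_eq, hψface] at hd; exact hd
  · change ψ d ≠ 0 ↔ ¬ ψ d.symm ≠ 0
    have hne := hC.isTrail.circulation_ne_zero hd
    rw [← hψ] at hne
    constructor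
    · intro h1 h2
      -- If both darts of an edge of `C` have nonzero winding number, then the vertex `d.fst` has
      -- only the two darts in `C`, both with nonzero winding number, and is not incident to the
      -- outer face.
      obtain ⟨e, hed, he, hne'⟩ := hC.exists_ne_dart hd
      have h3 : (P.rot d).edge ∈ C.edges := by
        rw [← Dart.edge_symm]
        exact hedge _ (by rwa [hψrot])
      have h4 : ψ (P.rot⁻¹ d) ≠ 0 := by
        rw [← hψface, facePerm_apply, Dart.symm_symm] at h2
        exact h2
      have hfix : P.rot d ≠ d := fun hfix => hne'
        (P.rot_induction (p := fun e => e = d) hed.symm rfl fun d' _ h => by rw [h, hfix])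
      have h5 : P.rot d = e :=
        (hC.eq_or_eq_dart hd he h3 hed (P.rot_fst d) hne').resolve_left hfix
      have hinv : P.rot (P.rot⁻¹ d) = d := P.rot.apply_symm_apply d
      have h6 : P.rot⁻¹ d = e := by
        refine (hC.eq_or_eq_dart hd he (hedge _ h4) hed ?_ hne').resolve_left fun h => hfix ?_
        · rw [← P.rot_fst, hinv]
        · rwa [h] at hinv
      obtain ⟨f, hf, hfd⟩ := hvert d.fst
      have h7 : f = d ∨ f = e := P.rot_induction (p := fun f => f = d ∨ f = e) hfd.symm (.inl rfl)
        fun d' _ h => h.elim (fun h => .inr (h ▸ h5)) fun h => .inl (by rw [h, ← h6, hinv])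
      rcases h7 with rfl | rfl
      · exact h1 (hψout _ hf)
      · exact (h6 ▸ h4) (hψout _ hf)
    · intro h1 h2
      rw [h2, not_not.1 h1] at hne
      exact hne (sub_self 0)

/-- The darts of an outerplanar embedding of a cactus that have the interior of a cycle to their
left. At each vertex of a cycle, one of the two cycle darts is inner, and the other one directly
follows it in counterclockwise order. -/
theorem exists_inner (hH : H.IsCactus) (hP : P.IsOuterplanar) : ∃ I : Set H.Dart,
    (∀ d ∈ I, d ∉ P.outer) ∧ ∀ {w : V} (C : H.Walk w w), C.IsCycle →
      (∀ d : H.Dart, d.edge ∈ C.edges → (d ∈ I ↔ d.symm ∉ I)) ∧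
      ∀ d e : H.Dart, d.edge ∈ C.edges → e.edge ∈ C.edges → e.fst = d.fst → e ≠ d →
        (d ∈ I → P.rot d = e) ∧ (d ∈ I ↔ e ∉ I) := by
  have hex : ∀ S : {S : H.Subgraph // ∃ w, ∃ C : H.Walk w w, C.IsCycle ∧ C.toSubgraph = S},
      ∃ I : Set H.Dart, (∀ d ∈ I, facePerm P.rot d ∈ I) ∧ (∀ d, facePerm P.rot d ∈ I → d ∈ I) ∧
      (∀ d ∈ I, d ∉ P.outer) ∧
      (∀ d ∈ I, d.edge ∈ S.1.edgeSet) ∧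
      ∀ d : H.Dart, d.edge ∈ S.1.edgeSet → (d ∈ I ↔ d.symm ∉ I) := by
    rintro ⟨_, w, C, hC, rfl⟩
    simp only [Walk.mem_edges_toSubgraph]
    exact P.exists_inner_of_isCycle hH hP hC
  choose J hJ₁ hJ₂ hJ₃ hJ₄ hJ₅ using hex
  refine ⟨⋃ S, J S, fun d hd => ?_, fun {w} C hC => ?_⟩
  · obtain ⟨S, hS⟩ := Set.mem_iUnion.1 hd
    exact hJ₃ S d hS
  let S : {S : H.Subgraph // ∃ w, ∃ C : H.Walk w w, C.IsCycle ∧ C.toSubgraph = S} :=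
    ⟨C.toSubgraph, w, C, hC, rfl⟩
  have hS : ∀ e, e ∈ S.1.edgeSet ↔ e ∈ C.edges := fun e => Walk.mem_edges_toSubgraph C
  have hI : ∀ d : H.Dart, d.edge ∈ C.edges → (d ∈ ⋃ S, J S ↔ d ∈ J S) := fun d hd => by
    refine ⟨fun h => ?_, fun h => Set.mem_iUnion.2 ⟨S, h⟩⟩
    obtain ⟨T, hT⟩ := Set.mem_iUnion.1 h
    suffices T = S from this ▸ hT
    obtain ⟨_, w', C', hC', rfl⟩ := T
    have := hJ₄ _ _ hT
    rw [Walk.mem_edges_toSubgraph] at this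
    exact Subtype.ext (hH.2 C' C hC' hC _ this hd)
  have hsymm : ∀ d : H.Dart, d.edge ∈ C.edges → (d ∈ J S ↔ d.symm ∉ J S) := fun d hd =>
    hJ₅ S d ((hS _).2 hd)
  have hrot : ∀ d e : H.Dart, d.edge ∈ C.edges → e.edge ∈ C.edges → e.fst = d.fst → e ≠ d →
      d ∈ J S → P.rot d = e ∧ e ∉ J S := by
    intro d e hd he hed hne hdJ
    have h1 : (P.rot d).symm ∈ J S := hJ₂ S _ (by rwa [facePerm_symm_rot])
    have h2 : (P.rot d).edge ∈ C.edges := by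
      rw [← Dart.edge_symm, ← hS]
      exact hJ₄ S _ h1
    have h3 : P.rot d ∉ J S := by
      rw [hsymm _ h2, not_not]
      exact h1
    obtain rfl := (hC.eq_or_eq_dart hd he h2 hed (P.rot_fst d) hne).resolve_left
      fun h => h3 (h.symm ▸ hdJ)
    exact ⟨rfl, h3⟩
  refine ⟨fun d hd => ?_, fun d e hd he hed hne => ?_⟩
  · rw [hI d hd, hI d.symm (d.edge_symm ▸ hd)]
    exact hsymm d hd
  · rw [hI d hd, hI e he]
    refine ⟨fun h => (hrot d e hd he hed hne h).1, fun h => (hrot d e hd he hed hne h).2,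
      fun h => ?_⟩
    by_contra hdJ
    have h1 : d.symm ∈ J S := by
      by_contra h'
      exact hdJ ((hsymm d hd).2 h')
    have h2 : P.rot⁻¹ d ∈ J S := by
      have := hJ₁ S _ h1
      rwa [facePerm_apply, Dart.symm_symm] at this
    have h3 := (hS _).1 (hJ₄ S _ h2)
    have h4 : (P.rot⁻¹ d).fst = d.fst := by
      rw [← P.rot_fst, show P.rot (P.rot⁻¹ d) = d from P.rot.apply_symm_apply d]
    rcases hC.eq_or_eq_dart hd he h3 hed h4 hne with h5 | h5
    · exact hdJ (h5 ▸ h2)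
    · exact h (h5 ▸ h2)

end PlaneEmbedding

/-! ### The left-to-right order of an embedding -/

namespace PlaneEmbedding

open SimpleGraph

variable {V : Type*} {H : SimpleGraph V} (P : PlaneEmbedding H)

theorem rot_rot_inv (d : H.Dart) : P.rot (P.rot⁻¹ d) = d := P.rot.apply_symm_apply d

theorem rot_inv_fst (d : H.Dart) : (P.rot⁻¹ d).fst = d.fst := by rw [← P.rot_fst, P.rot_rot_inv]

theorem facePerm_mem_outer {d : H.Dart} (hd : d ∈ P.outer) : facePerm P.rot d ∈ P.outer := by
  rcases P.outer_face with ⟨e, he⟩ | he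
  · rw [he] at hd ⊢
    exact hd.apply_right
  · exact he.elim d

variable [Finite V] {st : V → H.Dart}

theorem exists_pow_eq (hst : ∀ v, (st v).fst = v) (d : H.Dart) :
    ∃ n : ℕ, (P.rot ^ n) (st d.fst) = d :=
  (P.rot_cyclic _ _ (hst d.fst)).exists_nat_pow_eq

variable (hst : ∀ v, (st v).fst = v)

open scoped Classical in
/-- The position of a dart `d` in counterclockwise order around its initial vertex `v`, starting
from `st v`. -/
noncomputable def pos (d : H.Dart) : ℕ := Nat.find (P.exists_pow_eq hst d)

theorem pow_pos (d : H.Dart) : (P.rot ^ P.pos hst d) (st d.fst) = d := by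
  classical
  exact Nat.find_spec (P.exists_pow_eq hst d)

theorem pos_le {d : H.Dart} {n : ℕ} (h : (P.rot ^ n) (st d.fst) = d) : P.pos hst d ≤ n := by
  classical
  exact Nat.find_min' (P.exists_pow_eq hst d) h

theorem pos_injective {d e : H.Dart} (hde : d.fst = e.fst) (h : P.pos hst d = P.pos hst e) :
    d = e := by
  rw [← P.pow_pos hst d, ← P.pow_pos hst e, hde, h]

theorem pos_start (v : V) : P.pos hst (st v) = 0 :=
  Nat.le_zero.1 (P.pos_le hst (by rw [hst]; rfl))

theorem pos_pos {d : H.Dart} (hd : d ≠ st d.fst) : 0 < P.pos hst d := by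
  refine Nat.pos_of_ne_zero fun h => hd (P.pos_injective hst (hst d.fst).symm ?_)
  rw [h, P.pos_start]

theorem pos_rot {d : H.Dart} (hd : P.rot d ≠ st d.fst) : P.pos hst (P.rot d) = P.pos hst d + 1 := by
  have h1 : 0 < P.pos hst (P.rot d) := P.pos_pos hst (by rwa [P.rot_fst])
  refine le_antisymm (P.pos_le hst ?_) ?_
  · rw [P.rot_fst, pow_succ', Equiv.Perm.mul_apply, P.pow_pos]
  · obtain ⟨m, hm⟩ := Nat.exists_eq_succ_of_ne_zero h1.ne'
    have h2 := P.pow_pos hst (P.rot d)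
    rw [hm, Nat.succ_eq_add_one, pow_succ', Equiv.Perm.mul_apply, P.rot_fst] at h2
    rw [hm]
    exact Nat.succ_le_succ (P.pos_le hst (P.rot.injective h2))

theorem pos_lt_of_rot_eq {d e : H.Dart} (hd : P.rot d = st d.fst) (hde : e.fst = d.fst)
    (hne : e ≠ d) : P.pos hst e < P.pos hst d := by
  by_contra hlt
  have hlt' : P.pos hst d + 1 ≤ P.pos hst e :=
    Nat.succ_le_of_lt (lt_of_le_of_ne (not_lt.1 hlt)
      fun h => hne (P.pos_injective hst hde h.symm))
  have h1 : (P.rot ^ (P.pos hst d + 1)) (st d.fst) = st d.fst := by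
    rw [pow_succ', Equiv.Perm.mul_apply, P.pow_pos, hd]
  have h2 := P.pow_pos hst e
  rw [← Nat.sub_add_cancel hlt', pow_add, Equiv.Perm.mul_apply, hde, h1, ← hde] at h2
  have := P.pos_le hst h2
  omega

end PlaneEmbedding

namespace Digraph

open SimpleGraph

variable {V : Type*} [PartialOrder V] {G : Digraph V} {H : SimpleGraph V} {s : V}

/-- The dart of a directed edge. -/
def IsReachOrder.dart (h : G.IsReachOrder H) {u v : V} (huv : G.Adj u v) : H.Dart :=
  ⟨(u, v), (h.adj_iff _ _).2 (.inl huv)⟩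

theorem IsReachOrder.dart_injective (h : G.IsReachOrder H) {u v u' v' : V} {huv : G.Adj u v}
    {huv' : G.Adj u' v'} (heq : h.dart huv = h.dart huv') : u = u' ∧ v = v' :=
  ⟨congrArg (fun d : H.Dart => d.fst) heq, congrArg (fun d : H.Dart => d.snd) heq⟩

theorem IsReachOrder.dart_ne_symm (h : G.IsReachOrder H) {v f p : V} (hvf : G.Adj v f)
    (hpv : G.Adj p v) : h.dart hvf ≠ (h.dart hpv).symm := fun heq => by
  have : f = p := congrArg (fun d : H.Dart => d.snd) heq
  exact (h.adj_lt hvf).asymm (this ▸ h.adj_lt hpv)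

theorem IsRootedCactus.ne_root_of_adj {v p : V} (h : G.IsRootedCactus H s) (hpv : G.Adj p v) :
    v ≠ s :=
  fun hv => ((h.adj_lt hpv).trans_le (hv ▸ h.root_le p)).false

/-- The set `I` of the darts that have the interior of a cycle to their left, and at each vertex `v`
the dart `st v` from which on the counterclockwise order at `v` is read: at the root, the angle just
before `st v` belongs to the outer face, and at any other vertex `st v` is the first one of the at
most two incoming edges, with the interior of their cycle between the two. -/
structure IsCut (h : G.IsRootedCactus H s) (P : PlaneEmbedding H) (I : Set H.Dart)
    (st : V → H.Dart) : Prop where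
  fst : ∀ v, (st v).fst = v
  not_mem_outer : ∀ d ∈ I, d ∉ P.outer
  mem_iff : ∀ {r t} (B : G.Bigon H r t) (d : H.Dart), d.edge ∈ B.edges → (d ∈ I ↔ d.symm ∉ I)
  rot_eq : ∀ {r t} (B : G.Bigon H r t) (d e : H.Dart), d.edge ∈ B.edges → e.edge ∈ B.edges →
    e.fst = d.fst → e ≠ d → (d ∈ I → P.rot d = e) ∧ (d ∈ I ↔ e ∉ I)
  outer : P.rot⁻¹ (st s) ∈ P.outer
  adj : ∀ {v}, v ≠ s → G.Adj (st v).snd v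
  mem : ∀ {v q}, v ≠ s → G.Adj q v → q ≠ (st v).snd → st v ∈ I

variable {h : G.IsRootedCactus H s} {P : PlaneEmbedding H} {I : Set H.Dart} {st : V → H.Dart}

namespace IsCut

/-- On both sides of a bigon, the upward darts are either all inner or all not inner. -/
theorem mem_iff_of_adj (hc : IsCut h P I st) {r t p v f : V} (B : G.Bigon H r t)
    (hpv : G.Adj p v) (hvf : G.Adj v f) (hp : s(p, v) ∈ B.edges) (hf : s(v, f) ∈ B.edges) :
    h.dart hpv ∈ I ↔ h.dart hvf ∈ I := by
  have h1 := hc.mem_iff B (h.dart hpv) hp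
  have h2 := (hc.rot_eq B (h.dart hvf) (h.dart hpv).symm hf (by rwa [Dart.edge_symm]) rfl
    (h.dart_ne_symm hvf hpv).symm).2
  tauto

theorem mem_iff_of_walk (hc : IsCut h P I st) {r t x a v f : V} (B : G.Bigon H r t)
    (w : H.Walk a v) (hw : w.IsDirected G) (hwB : ∀ e ∈ w.edges, e ∈ B.edges) (hxa : G.Adj x a)
    (hvf : G.Adj v f) (hx : s(x, a) ∈ B.edges) (hf : s(v, f) ∈ B.edges) :
    h.dart hxa ∈ I ↔ h.dart hvf ∈ I := by
  induction w generalizing x with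
  | nil => exact hc.mem_iff_of_adj B hxa hvf hx hf
  | cons hab w ih =>
    rw [Walk.isDirected_cons] at hw
    rw [Walk.edges_cons] at hwB
    rw [hc.mem_iff_of_adj B hxa hw.1 hx (hwB _ List.mem_cons_self)]
    exact ih hw.2 (fun e he => hwB e (List.mem_cons_of_mem _ he)) hw.1 hvf
      (hwB _ List.mem_cons_self) hf

theorem dart_right_mem (hc : IsCut h P I st) {r t c d : V} (B : G.Bigon H r t) (hrc : G.Adj r c)
    (hrd : G.Adj r d) (hB : s(r, c) ∈ B.edges) (hB' : s(r, d) ∈ B.edges) (hne : c ≠ d)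
    (hI : h.dart hrc ∉ I) : h.dart hrd ∈ I :=
  (hc.rot_eq B (h.dart hrd) (h.dart hrc) hB' hB rfl
    fun heq => hne (h.dart_injective heq).2).2.2 hI

end IsCut

variable [Finite V]

/-- At a vertex with two incoming edges, the first one is the one whose dart out of the vertex is
inner. -/
theorem exists_isCut (h : G.IsRootedCactus H s) (hP : P.IsOuterplanar) [Nonempty H.Dart] :
    ∃ I st, IsCut h P I st := by
  obtain ⟨I, hI₁, hI₂⟩ := P.exists_inner h.isCactus hP
  have mem_iff : ∀ {r t} (B : G.Bigon H r t) (d : H.Dart), d.edge ∈ B.edges →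
      (d ∈ I ↔ d.symm ∉ I) := fun B d hd =>
    (hI₂ B.cycle (B.isCycle h.toIsReachOrder)).1 d (B.mem_edges_cycle.2 hd)
  have rot_eq : ∀ {r t} (B : G.Bigon H r t) (d e : H.Dart), d.edge ∈ B.edges →
      e.edge ∈ B.edges → e.fst = d.fst → e ≠ d → (d ∈ I → P.rot d = e) ∧ (d ∈ I ↔ e ∉ I) :=
    fun B d e hd he => (hI₂ B.cycle (B.isCycle h.toIsReachOrder)).2 d e
      (B.mem_edges_cycle.2 hd) (B.mem_edges_cycle.2 he)
  have hex : ∀ v, ∃ d : H.Dart, d.fst = v ∧ (v = s → P.rot⁻¹ d ∈ P.outer) ∧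
      (v ≠ s → G.Adj d.snd v ∧ ∀ q, G.Adj q v → q ≠ d.snd → d ∈ I) := by
    intro v
    by_cases hv : v = s
    · obtain ⟨d, hd, hdv⟩ := (hP.resolve_right (not_isEmpty_iff.2 inferInstance)) v
      refine ⟨P.rot d, (P.rot_fst d).trans hdv, fun _ => ?_, fun hv' => absurd hv hv'⟩
      rwa [show P.rot⁻¹ (P.rot d) = d from P.rot.symm_apply_apply d]
    · obtain ⟨p, -, hp⟩ := h.exists_le_adj (lt_of_le_of_ne (h.root_le v) (Ne.symm hv))
      by_cases hq : ∃ q, G.Adj q v ∧ q ≠ p ∧ (h.dart hp).symm ∉ I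
      · obtain ⟨q, hq, hqp, hpI⟩ := hq
        obtain ⟨r, B, hB₁, hB₂⟩ := h.exists_bigon_sink hq hp hqp
        refine ⟨(h.dart hq).symm, rfl, fun h' => absurd h' hv, fun _ => ⟨hq, fun _ _ _ => ?_⟩⟩
        refine (rot_eq B (h.dart hq).symm (h.dart hp).symm ?_ ?_ rfl ?_).2.2 hpI
        · rwa [Dart.edge_symm]
        · rwa [Dart.edge_symm]
        · intro heq
          exact hqp (h.dart_injective (Dart.symm_involutive.injective heq)).1.symm
      · push Not at hq
        exact ⟨(h.dart hp).symm, rfl, fun h' => absurd h' hv, fun _ => ⟨hp, hq⟩⟩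
  choose st hst₁ hst₂ hst₃ using hex
  exact ⟨I, st, hst₁, hI₁, mem_iff, rot_eq, hst₂ s rfl, fun hv => (hst₃ _ hv).1,
    fun hv hq hne => (hst₃ _ hv).2 _ hq hne⟩

namespace IsCut

open scoped Classical in
/-- The left-to-right order of the outgoing edges of an embedding: the outgoing edges are met from
right to left in counterclockwise order, hence the sign. The value for a non-edge is irrelevant. -/
noncomputable def key (hc : IsCut h P I st) (v c : V) : ℤ :=
  if a : H.Adj v c then -(P.pos hc.fst ⟨(v, c), a⟩ : ℤ) else 0

theorem key_eq (hc : IsCut h P I st) {v c : V} (hvc : G.Adj v c) :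
    hc.key v c = -(P.pos hc.fst (h.dart hvc) : ℤ) :=
  dif_pos ((h.adj_iff _ _).2 (.inl hvc))

theorem pos_dart_injective (hc : IsCut h P I st) {v c d : V} (hvc : G.Adj v c) (hvd : G.Adj v d)
    (heq : P.pos hc.fst (h.dart hvc) = P.pos hc.fst (h.dart hvd)) : c = d :=
  (h.dart_injective (P.pos_injective hc.fst (d := h.dart hvc) (e := h.dart hvd) rfl heq)).2

theorem key_inj (hc : IsCut h P I st) {v c d : V} (hvc : G.Adj v c) (hvd : G.Adj v d)
    (heq : hc.key v c = hc.key v d) : c = d := by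
  rw [hc.key_eq hvc, hc.key_eq hvd, neg_inj, Nat.cast_inj] at heq
  exact hc.pos_dart_injective hvc hvd heq

/-- The two edges at the source of a bigon are consecutive, and the rotation is not cut open between
them. -/
theorem key_eq_sub_one (hc : IsCut h P I st) {r t c d : V} (B : G.Bigon H r t) (hrc : G.Adj r c)
    (hrd : G.Adj r d) (hB : s(r, c) ∈ B.edges) (hB' : s(r, d) ∈ B.edges) (hne : c ≠ d)
    (hI : h.dart hrc ∈ I) : hc.key r d = hc.key r c - 1 := by
  have h1 := (hc.rot_eq B (h.dart hrc) (h.dart hrd) hB hB' rfl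
    fun heq => hne (h.dart_injective heq).2.symm).1 hI
  have h2 : P.rot (h.dart hrc) ≠ st (h.dart hrc).fst := by
    intro h3
    change _ = st r at h3
    by_cases hr : r = s
    · refine hc.not_mem_outer _ hI ?_
      have := hc.outer
      rwa [← hr, ← h3, show P.rot⁻¹ (P.rot (h.dart hrc)) = _ from P.rot.symm_apply_apply _] at this
    · have h4 := hc.adj hr
      rw [← h3, h1] at h4
      exact (h.adj_lt h4).asymm (h.adj_lt hrd)
  have h3 := P.pos_rot hc.fst h2
  rw [h1] at h3
  rw [hc.key_eq hrc, hc.key_eq hrd, h3]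
  push_cast
  ring

theorem notMem_of_key_lt (hc : IsCut h P I st) {r t c d : V} (B : G.Bigon H r t) (hrc : G.Adj r c)
    (hrd : G.Adj r d) (hB : s(r, c) ∈ B.edges) (hB' : s(r, d) ∈ B.edges)
    (hlt : hc.key r c < hc.key r d) : h.dart hrc ∉ I := fun hI => by
  have := hc.key_eq_sub_one B hrc hrd hB hB' (fun hcd => (hcd ▸ hlt).false) hI
  omega

/-- At an inner vertex `v` of a side of a bigon, the incoming edge is unique, so it is the start of
the rotation. -/
theorem start_eq (hc : IsCut h P I st) {r t p v f : V} (B : G.Bigon H r t)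
    (hpv : G.Adj p v) (hvf : G.Adj v f) (hp : s(p, v) ∈ B.edges) (hf : s(v, f) ∈ B.edges) :
    st v = (h.dart hpv).symm := by
  have hv : v ≠ s := h.ne_root_of_adj hpv
  have h1 := h.eq_of_mem_bigon B hp hf hpv (hc.adj hv) hvf
  exact Dart.ext _ _ (Prod.ext (hc.fst v) h1.symm)

/-- An upward dart of a cycle is inner if and only if it is on the right side. So at an inner vertex
of the left side the cycle edge comes directly after the incoming edge in counterclockwise order,
and at one of the right side it comes directly before it, that is, last. -/
theorem isOuterplanarKey (hc : IsCut h P I st)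
    (hnt : ∀ r c d, G.Adj r c → G.Adj r d → c ≤ d → c = d) : G.IsOuterplanarKey hc.key := by
  refine ⟨hc.key_inj, ?_, ?_, ?_, fun hrc hrd hne hle => absurd (hnt _ _ _ hrc hrd hle) hne⟩
  · intro r c d e z hrc hrd hre hcz hdz h1 h2
    have hne : c ≠ d := fun hcd => (hcd ▸ h1.trans h2).false
    obtain ⟨t, B, hB, hB'⟩ := h.exists_bigon_root hrc hrd hne hcz hdz
    have h3 := hc.dart_right_mem B hrc hrd hB hB' hne
      (hc.notMem_of_key_lt B hrc hrd hB hB' (h1.trans h2))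
    have := hc.key_eq_sub_one B hrd hrc hB' hB hne.symm h3
    omega
  · intro r c d v f g o hlt hvg hgf
    obtain ⟨t, B, w, hw, hwB, hrc, hrd, hvf, p, hpv, hp⟩ := o.exists_bigon h.toIsReachOrder
    have h1 := hc.notMem_of_key_lt B o.adj_left o.adj_right hrc hrd hlt
    rw [hc.mem_iff_of_walk B w hw hwB o.adj_left o.adj hrc hvf] at h1
    have hstart := hc.start_eq B hpv o.adj hp hvf
    have hne := h.dart_ne_symm o.adj hpv
    have h2 := hc.rot_eq B (h.dart hpv).symm (h.dart o.adj) (by rwa [Dart.edge_symm]) hvf rfl hne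
    have h3 := h2.1 (h2.2.2 h1)
    rw [← hstart] at h3
    have h4 : P.pos hc.fst (h.dart o.adj) = 1 := by
      have h5 : P.rot (st v) ≠ st (st v).fst := by
        rw [hc.fst, h3, hstart]
        exact hne
      rw [← h3, P.pos_rot hc.fst h5, P.pos_start]
    have h5 : 0 < P.pos hc.fst (h.dart hvg) :=
      P.pos_pos hc.fst (by
        change _ ≠ st v
        rw [hstart]
        exact h.dart_ne_symm hvg hpv)
    have h6 : P.pos hc.fst (h.dart hvg) ≠ 1 := fun h7 =>
      hgf (hc.pos_dart_injective hvg o.adj (h7.trans h4.symm))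
    rw [hc.key_eq hvg, hc.key_eq o.adj, h4]
    omega
  · intro r c d v f g o hlt hvg hgf
    obtain ⟨t, B, w, hw, hwB, hrc, hrd, hvf, p, hpv, hp⟩ := o.exists_bigon h.toIsReachOrder
    have h1 := hc.dart_right_mem B o.adj_right o.adj_left hrd hrc o.ne.symm
      (hc.notMem_of_key_lt B o.adj_right o.adj_left hrd hrc hlt)
    rw [hc.mem_iff_of_walk B w hw hwB o.adj_left o.adj hrc hvf] at h1
    have hstart := hc.start_eq B hpv o.adj hp hvf
    have h2 := (hc.rot_eq B (h.dart o.adj) (h.dart hpv).symm hvf (by rwa [Dart.edge_symm]) rfl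
      (h.dart_ne_symm o.adj hpv).symm).1 h1
    rw [← hstart] at h2
    have h3 := P.pos_lt_of_rot_eq hc.fst (d := h.dart o.adj) (e := h.dart hvg) h2 rfl
      fun heq => hgf (h.dart_injective heq).2
    rw [hc.key_eq hvg, hc.key_eq o.adj]
    omega

end IsCut

end Digraph

/-! ### The drawing of an embedding -/

/-- The relation `LDrawing.CcwBefore` for the darts of any graph, so that it also applies to the
underlying graph of the reverse of `G`. -/
def LDrawing.Precedes {V : Type*} (D : LDrawing V) (G : Digraph V) {H : SimpleGraph V}
    (d e : H.Dart) : Prop :=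
  (G.Adj d.snd d.fst ∧ G.Adj e.fst e.snd) ∨
  (G.Adj d.snd d.fst ∧ G.Adj e.snd e.fst ∧ D.x d.snd < D.x e.snd) ∨
  (G.Adj d.fst d.snd ∧ G.Adj e.fst e.snd ∧ D.y e.snd < D.y d.snd)

namespace Digraph.IsCut

open SimpleGraph

variable {V : Type*} [PartialOrder V] [Finite V] {G : Digraph V} {H : SimpleGraph V} {s : V}
  {h : G.IsRootedCactus H s} {P : PlaneEmbedding H} {I : Set H.Dart} {st : V → H.Dart}

/-- An incoming edge other than the first one directly follows the first one. -/
theorem rot_start (hc : IsCut h P I st) {v q : V} (hqv : G.Adj q v)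
    (hne : (h.dart hqv).symm ≠ st v) :
    P.rot (st v) = (h.dart hqv).symm ∧ (h.dart hqv).symm ∉ I := by
  have hv := h.ne_root_of_adj hqv
  have hsv : st v = (h.dart (hc.adj hv)).symm := Dart.ext _ _ (Prod.ext (hc.fst v) rfl)
  have hqs : q ≠ (st v).snd := fun hq => hne (Dart.ext _ _ (Prod.ext (hc.fst v).symm hq))
  obtain ⟨r, B, hB, hB'⟩ := h.exists_bigon_sink hqv (hc.adj hv) hqs
  have h1 := hc.rot_eq B (st v) (h.dart hqv).symm (by rw [hsv, Dart.edge_symm]; exact hB')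
    (by rw [Dart.edge_symm]; exact hB) (hc.fst v).symm hne
  have h2 := hc.mem hv hqv hqs
  exact ⟨h1.1 h2, h1.2.1 h2⟩

theorem pos_in (hc : IsCut h P I st) {v q : V} (hqv : G.Adj q v)
    (hne : (h.dart hqv).symm ≠ st v) : P.pos hc.fst (h.dart hqv).symm = 1 := by
  have h1 := (hc.rot_start hqv hne).1
  rw [← h1, P.pos_rot hc.fst (d := st v), P.pos_start]
  rwa [hc.fst, h1]

/-- The tail of the first incoming edge lies to the left of the tail of the second one. -/
theorem leftOf_of_mem (hc : IsCut h P I st)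
    (hnt : ∀ r c d, G.Adj r c → G.Adj r d → c ≤ d → c = d) {v p q : V} (hpv : G.Adj p v)
    (hqv : G.Adj q v) (hpq : p ≠ q) (hI : (h.dart hpv).symm ∈ I) : G.LeftOf hc.key p q := by
  have hinc : ∀ {p q}, G.Adj p v → G.Adj q v → p ≠ q → ¬ p ≤ q := fun {p q} hp hq hne hle => by
    obtain ⟨c, hpc, hcq⟩ := h.exists_adj_le (lt_of_le_of_ne hle hne)
    have hcv := hcq.trans_lt (h.adj_lt hq)
    exact hcv.ne (hnt p c v hpc hp hcv.le)
  obtain ⟨w, c, d, -, a⟩ := h.exists_separates (h.root_le p) (h.root_le q) (hinc hpv hqv hpq)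
    (hinc hqv hpv hpq.symm)
  refine ⟨w, c, d, a, ?_⟩
  obtain ⟨W, hW⟩ := h.exists_walk a.le_left
  have hwp : w < p := (h.adj_lt a.adj_left).trans_le a.le_left
  obtain ⟨t, B, hB, hpB, hdB, -⟩ := h.exists_bigon
    (.cons ((h.adj_iff _ _).2 (.inl a.adj_left)) W) (Walk.isDirected_cons.2 ⟨a.adj_left, hW⟩) hpv
    a.adj_right le_rfl (a.le_right.trans (h.adj_lt hqv).le) a.not_le_right (.inl hwp.ne')
  have hcB : s(w, c) ∈ B.edges := hB _ (by simp)
  have h1 := hc.mem_iff_of_walk B W hW (fun e he => hB e (by simp [he])) a.adj_left hpv hcB hpB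
  have h2 : h.dart a.adj_left ∉ I := by
    rw [h1, hc.mem_iff B (h.dart hpv) hpB, not_not]
    exact hI
  have hcd : c ≠ d := fun hcd => a.not_le_left (hcd ▸ a.le_right)
  have := hc.key_eq_sub_one B a.adj_right a.adj_left hdB hcB hcd.symm
    (hc.dart_right_mem B a.adj_left a.adj_right hcB hdB hcd h2)
  omega

theorem leftOf_of_key_lt (hc : IsCut h P I st)
    (hnt : ∀ r c d, G.Adj r c → G.Adj r d → c ≤ d → c = d) {v c d : V} (hvc : G.Adj v c)
    (hvd : G.Adj v d) (hlt : hc.key v c < hc.key v d) : G.LeftOf hc.key c d := by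
  have hcd : c ≠ d := fun hcd => (hcd ▸ hlt).false
  exact ⟨v, c, d, ⟨hvc, hvd, le_rfl, fun hle => hcd (hnt _ _ _ hvc hvd hle), le_rfl,
    fun hle => hcd (hnt _ _ _ hvd hvc hle).symm⟩, hlt⟩

theorem pos_lt_of_in_of_out (hc : IsCut h P I st) {v p f : V} (hpv : G.Adj p v)
    (hvf : G.Adj v f) : P.pos hc.fst (h.dart hpv).symm < P.pos hc.fst (h.dart hvf) := by
  have hv := h.ne_root_of_adj hpv
  have h1 : h.dart hvf ≠ st v := fun heq => by
    have := hc.adj hv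
    rw [← heq] at this
    exact (h.adj_lt this).asymm (h.adj_lt hvf)
  have h2 : 0 < P.pos hc.fst (h.dart hvf) := P.pos_pos hc.fst h1
  by_cases h3 : (h.dart hpv).symm = st v
  · rwa [h3, P.pos_start]
  · have h4 := hc.pos_in hpv h3
    have h5 : P.pos hc.fst (h.dart hvf) ≠ P.pos hc.fst (h.dart hpv).symm := fun heq =>
      h.dart_ne_symm hvf hpv
        (P.pos_injective hc.fst (d := h.dart hvf) (e := (h.dart hpv).symm) rfl heq)
    omega

variable {D : LDrawing V}

/-- The counterclockwise order of the drawing is the order of the cut rotations. -/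
theorem pos_lt_of_precedes (hc : IsCut h P I st)
    (hnt : ∀ r c d, G.Adj r c → G.Adj r d → c ≤ d → c = d) (hD : D.IsDominance G hc.key)
    {d e : H.Dart} (hde : e.fst = d.fst) (hprec : D.Precedes G d e) :
    P.pos hc.fst d < P.pos hc.fst e := by
  obtain ⟨⟨v, p⟩, hvp⟩ := d
  obtain ⟨⟨v', q⟩, hvq⟩ := e
  obtain rfl : v' = v := hde
  have hk := hc.isOuterplanarKey hnt
  rcases hprec with ⟨hd, he⟩ | ⟨hd, he, hx⟩ | ⟨hd, he, hy⟩
  · exact hc.pos_lt_of_in_of_out hd he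
  · change G.Adj p v' at hd
    change G.Adj q v' at he
    change D.x p < D.x q at hx
    change P.pos hc.fst (h.dart hd).symm < P.pos hc.fst (h.dart he).symm
    have hpq : p ≠ q := fun hpq => (hpq ▸ hx).false
    have hv := h.ne_root_of_adj hd
    have hne : (h.dart he).symm ≠ st v' := fun heq => by
      have hqs : (st v').snd = q := congrArg (fun d : H.Dart => d.snd) heq.symm
      have hI := hc.mem hv hd (hqs.symm ▸ hpq)
      rw [← heq] at hI
      exact hx.asymm ((hD.x_lt_iff _ _).2 (.inr (hc.leftOf_of_mem hnt he hd hpq.symm hI)))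
    rw [hc.pos_in he hne]
    by_cases hne' : (h.dart hd).symm = st v'
    · rw [hne', P.pos_start]
      exact one_pos
    · have := (hc.rot_start hd hne').1.symm.trans (hc.rot_start he hne).1
      exact absurd (h.dart_injective (Dart.symm_involutive.injective this)).1 hpq
  · change G.Adj v' p at hd
    change G.Adj v' q at he
    change D.y q < D.y p at hy
    change P.pos hc.fst (h.dart hd) < P.pos hc.fst (h.dart he)
    have hlt : hc.key v' q < hc.key v' p := by
      rcases lt_trichotomy (hc.key v' q) (hc.key v' p) with hlt | heq | hlt
      · exact hlt
      · exact absurd (hc.key_inj he hd heq ▸ hy) (lt_irrefl _)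
      · exact absurd ((hD.y_lt_iff _ _).2 (.inr (hc.leftOf_of_key_lt hnt hd he hlt))) hy.asymm
    rw [hc.key_eq hd, hc.key_eq he] at hlt
    omega

/-- The positions of `d` and `P.rot d` are consecutive, except that `P.rot d` may be the start of
the cut rotation and `d` its end. -/
theorem not_between (hc : IsCut h P I st)
    (hnt : ∀ r c d, G.Adj r c → G.Adj r d → c ≤ d → c = d) (hD : D.IsDominance G hc.key)
    {d e : H.Dart} (hde : e.fst = d.fst) :
    ¬ ((D.Precedes G d e ∧ D.Precedes G e (P.rot d)) ∨
      (D.Precedes G e (P.rot d) ∧ D.Precedes G (P.rot d) d) ∨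
      (D.Precedes G (P.rot d) d ∧ D.Precedes G d e)) := by
  have h1 := fun h' => hc.pos_lt_of_precedes hnt hD (d := d) (e := e) hde h'
  have h2 := fun h' => hc.pos_lt_of_precedes hnt hD (d := e) (e := P.rot d)
    ((P.rot_fst d).trans hde.symm) h'
  have h3 := fun h' => hc.pos_lt_of_precedes hnt hD (d := P.rot d) (e := d) (P.rot_fst d).symm h'
  by_cases hd : P.rot d = st d.fst
  · have h4 : P.pos hc.fst (P.rot d) = 0 := by rw [hd, P.pos_start]
    have h5 : e ≠ d → P.pos hc.fst e < P.pos hc.fst d := P.pos_lt_of_rot_eq hc.fst hd hde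
    have h6 : e = d → P.pos hc.fst e = P.pos hc.fst d := fun h' => h' ▸ rfl
    rintro (⟨h7, h8⟩ | ⟨h7, h8⟩ | ⟨h7, h8⟩)
    · have := h2 h8; omega
    · have := h2 h7; omega
    · have := h1 h8
      by_cases h9 : e = d
      · have := h6 h9; omega
      · have := h5 h9; omega
  · have h4 := P.pos_rot hc.fst hd
    rintro (⟨h7, h8⟩ | ⟨h7, h8⟩ | ⟨h7, h8⟩)
    · have := h1 h7; have := h2 h8; omega
    · have := h3 h8; omega
    · have := h3 h7; omega

theorem rot_inv_start_lt (hc : IsCut h P I st) {v : V} {d : H.Dart} (hd : d.fst = v)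
    (hne : d ≠ P.rot⁻¹ (st v)) : P.pos hc.fst d < P.pos hc.fst (P.rot⁻¹ (st v)) := by
  have hfst : (P.rot⁻¹ (st v)).fst = v := (P.rot_inv_fst _).trans (hc.fst v)
  exact P.pos_lt_of_rot_eq hc.fst (by rw [P.rot_rot_inv, hfst]) (hd.trans hfst.symm) hne

/-- The dart before the start of the rotation is the leftmost outgoing edge. -/
theorem exists_leftmost (hc : IsCut h P I st) {v g : V} (hvg : G.Adj v g) :
    ∃ f, ∃ hvf : G.Adj v f, P.rot⁻¹ (st v) = h.dart hvf ∧
      ∀ g', G.Adj v g' → g' ≠ f → hc.key v f < hc.key v g' := by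
  have hfst : (P.rot⁻¹ (st v)).fst = v := (P.rot_inv_fst _).trans (hc.fst v)
  generalize hd : P.rot⁻¹ (st v) = d at hfst
  obtain ⟨⟨v', f⟩, hvf⟩ := d
  obtain rfl : v' = v := hfst
  have hlast : ∀ e : H.Dart, e.fst = v' → e ≠ ⟨(v', f), hvf⟩ →
      P.pos hc.fst e < P.pos hc.fst ⟨(v', f), hvf⟩ := fun e he hne => by
    rw [← hd] at hne ⊢
    exact hc.rot_inv_start_lt he hne
  rcases (h.adj_iff _ _).1 hvf with a | a
  · refine ⟨f, a, rfl, fun g' hg' hne => ?_⟩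
    have := hlast (h.dart hg') rfl fun heq => hne (congrArg (fun d : H.Dart => d.snd) heq)
    rw [hc.key_eq a, hc.key_eq hg']
    exact neg_lt_neg (Int.ofNat_lt.2 this)
  · have h1 := hlast (h.dart hvg) rfl (h.dart_ne_symm hvg a)
    exact absurd (hc.pos_lt_of_in_of_out a hvg) h1.asymm

theorem mem_outer_of_lowest (hc : IsCut h P I st)
    (hnt : ∀ r c d, G.Adj r c → G.Adj r d → c ≤ d → c = d) (hD : D.IsDominance G hc.key)
    {d : H.Dart} (hv : ∀ v, D.y d.fst ≤ D.y v) (hw : ∀ w, G.Adj d.fst w → D.y d.snd ≤ D.y w) :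
    d ∈ P.outer := by
  obtain ⟨⟨v, g⟩, hvg⟩ := d
  obtain rfl : s = v := by
    by_contra hne
    exact (hv s).not_gt ((hD.y_lt_iff _ _).2 (.inl (lt_of_le_of_ne (h.root_le v) hne)))
  have hg : G.Adj s g := ((h.adj_iff _ _).1 hvg).resolve_right fun a => h.ne_root_of_adj a rfl
  obtain ⟨f, hf, heq, hlt⟩ := hc.exists_leftmost hg
  have hgf : g = f := by
    by_contra hne
    exact (hw f hf).not_gt ((hD.y_lt_iff _ _).2 (.inr
      (hc.leftOf_of_key_lt hnt hf hg (hlt g hg hne))))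
  subst hgf
  have := hc.outer
  rwa [heq] at this

/-- An incoming edge whose left face is the outer face is the first incoming edge. -/
theorem start_eq_of_mem_outer (hc : IsCut h P I st) {u v : V} (huv : G.Adj u v)
    (ho : h.dart huv ∈ P.outer) : st v = (h.dart huv).symm := by
  by_contra hne
  have hI := (hc.rot_start huv (Ne.symm hne)).2
  have hv := h.ne_root_of_adj huv
  have hqs : u ≠ (st v).snd := fun hq => hne (Dart.ext _ _ (Prod.ext (hc.fst v) hq.symm))
  obtain ⟨r, B, hB, -⟩ := h.exists_bigon_sink huv (hc.adj hv) hqs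
  have h1 := hc.mem_iff B (h.dart huv) hB
  exact hc.not_mem_outer _ (h1.2 hI) ho

/-- Following the outer face from the root along the leftmost edges, one arrives at a sink that lies
to the left of all vertices. -/
theorem exists_leftmost_sink (hc : IsCut h P I st)
    (hnt : ∀ r c d, G.Adj r c → G.Adj r d → c ≤ d → c = d) :
    ∃ v, (v = s ∨ ∃ u, ∃ huv : G.Adj u v, h.dart huv ∈ P.outer) ∧ (∀ z, ¬ G.LeftOf hc.key z v) ∧
      ∀ f, ¬ G.Adj v f := by
  have hk := hc.isOuterplanarKey hnt
  obtain ⟨v, -, hv⟩ := (Set.toFinite {v | (v = s ∨ ∃ u, ∃ huv : G.Adj u v, h.dart huv ∈ P.outer) ∧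
    ∀ z, ¬ G.LeftOf hc.key z v}).exists_le_maximal (a := s)
    ⟨.inl rfl, fun z hz => hz.not_ge (h.root_le z)⟩
  refine ⟨v, hv.prop.1, hv.prop.2, fun g hvg => ?_⟩
  obtain ⟨f, hf, heq, hlt⟩ := hc.exists_leftmost hvg
  have hfo : h.dart hf ∈ P.outer := by
    rw [← heq]
    rcases hv.prop.1 with hvs | ⟨u, huv, ho⟩
    · rw [hvs]
      exact hc.outer
    · rw [hc.start_eq_of_mem_outer huv ho]
      exact P.facePerm_mem_outer ho
  have hleft : ∀ z, ¬ G.LeftOf hc.key z f := fun z hz => by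
    by_cases hzv : z ≤ v
    · exact hz.not_le (hzv.trans (h.adj_lt hf).le)
    by_cases hvz : v ≤ z
    · obtain ⟨e, he, hez⟩ := h.exists_adj_le (lt_of_le_of_ne hvz fun h' => hzv h'.ge)
      have hef : e ≠ f := fun hef => hz.not_ge (hef ▸ hez)
      exact h.leftOf_asymm hk hz ⟨v, f, e, ⟨hf, he, le_rfl, hz.not_ge, hez,
        fun hle => hef (hnt _ _ _ he hf hle)⟩, hlt e he hef⟩
    rcases h.leftOf_or_leftOf hk hzv hvz with h1 | h1
    · exact hv.prop.2 z h1
    · exact (h.leftOf_trans hk h1 hz).not_le (h.adj_lt hf).le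
  exact ((hv.le_of_ge ⟨.inr ⟨v, hf, hfo⟩, hleft⟩ (h.adj_lt hf).le).trans_lt (h.adj_lt hf)).false

theorem mem_outer_of_leftmost (hc : IsCut h P I st)
    (hnt : ∀ r c d, G.Adj r c → G.Adj r d → c ≤ d → c = d) (hD : D.IsDominance G hc.key)
    {u v : V} (huv : G.Adj u v) (hv : ∀ z, D.x v ≤ D.x z) (hu : ∀ w, G.Adj w v → D.x u ≤ D.x w) :
    h.dart huv ∈ P.outer := by
  have hk := hc.isOuterplanarKey hnt
  obtain ⟨v', hv', hleft, hsink⟩ := hc.exists_leftmost_sink hnt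
  obtain rfl : v' = v := by
    by_contra hne
    refine (hv v').not_gt ((hD.x_lt_iff _ _).2 ?_)
    by_cases h1 : v ≤ v'
    · exact .inl (lt_of_le_of_ne h1 (Ne.symm hne))
    by_cases h2 : v' ≤ v
    · obtain ⟨f, hf, -⟩ := h.exists_adj_le (lt_of_le_of_ne h2 hne)
      exact absurd hf (hsink f)
    exact .inr ((h.leftOf_or_leftOf hk h1 h2).resolve_left (hleft v))
  obtain ⟨u', hu', ho⟩ := hv'.resolve_left (h.ne_root_of_adj huv)
  have hstart := hc.start_eq_of_mem_outer hu' ho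
  have hqs : u' = (st v').snd := by rw [hstart]; rfl
  have huu : u' = u := by
    by_contra hne
    have hI := hc.mem (h.ne_root_of_adj huv) huv (fun h' => hne (hqs.trans h'.symm))
    rw [hstart] at hI
    exact (hu u' hu').not_gt ((hD.x_lt_iff _ _).2 (.inr (hc.leftOf_of_mem hnt hu' huv hne hI)))
  subst huu
  exact ho

end Digraph.IsCut

/-! ### Digraphs with a single source -/

namespace Digraph

variable {V : Type*} {G : Digraph V} {H : SimpleGraph V}

/-- Reachability in an acyclic digraph. -/
abbrev reachOrder (hG : G.IsAcyclic) : PartialOrder V where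
  le := Relation.ReflTransGen G.Adj
  le_refl _ := .refl
  le_trans _ _ _ := .trans
  le_antisymm u v huv hvu := by
    rcases Relation.reflTransGen_iff_eq_or_transGen.1 huv with h | h
    · exact h.symm
    · exact absurd (h.trans_left hvu) (hG u)

theorem isReachOrder (hG : G.IsAcyclic) (hadj : ∀ u v, H.Adj u v ↔ G.Adj u v ∨ G.Adj v u) :
    letI := reachOrder hG
    G.IsReachOrder H :=
  letI := reachOrder hG
  { le_iff := fun _ _ => Iff.rfl
    adj_iff := hadj
    adj_lt := fun {u v} huv => lt_of_le_of_ne (Relation.ReflTransGen.single huv) fun h =>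
      hG u (.single (by rwa [← h] at huv)) }

theorem isRootedCactus [Finite V] (hG : G.IsAcyclic)
    (hadj : ∀ u v, H.Adj u v ↔ G.Adj u v ∨ G.Adj v u) (hH : H.IsCactus) {s : V}
    (hs : ∀ v, G.IsSource v → v = s) :
    letI := reachOrder hG
    G.IsRootedCactus H s := by
  let := reachOrder hG
  have h := isReachOrder hG hadj
  refine { h with isCactus := hH, root_le := fun v => ?_ }
  obtain ⟨m, hm, hmin⟩ := (Set.finite_univ (α := V)).exists_le_minimal (Set.mem_univ v)
  rw [← hs m fun u hu => hmin.not_lt (Set.mem_univ u) (h.adj_lt hu)]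
  exact hm

theorem exists_drawing [Finite V] (hG : G.IsAcyclic)
    (hadj : ∀ u v, H.Adj u v ↔ G.Adj u v ∨ G.Adj v u) (hH : H.IsCactus) {s : V}
    (hs : ∀ v, G.IsSource v → v = s) :
    ∃ D : LDrawing V, D.IsUpwardLeftward G ∧ D.IsOuterplanar G ∧ D.OnGrid := by
  let := reachOrder hG
  have h := isRootedCactus hG hadj hH hs
  obtain ⟨k, hk⟩ := h.exists_isOuterplanarKey
  obtain ⟨D, hD⟩ := LDrawing.exists_isDominance h hk
  exact ⟨D, hD.isUpwardLeftward h.toIsReachOrder, hD.isOuterplanar h hk, hD.onGrid⟩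

/-- The last three conditions say that the drawing maintains the embedding. The very last one
describes the outer face at the leftmost vertex; it becomes the condition on the lowest vertex when
the coordinates are exchanged. -/
theorem exists_drawing_of_embedding [Finite V] (hG : G.IsAcyclic)
    (hadj : ∀ u v, H.Adj u v ↔ G.Adj u v ∨ G.Adj v u) (hH : H.IsCactus) {s : V}
    (hs : ∀ v, G.IsSource v → v = s) (hnt : ∀ u v, ¬ G.IsTransitiveEdge u v)
    (P : PlaneEmbedding H) (hP : P.IsOuterplanar) :
    ∃ D : LDrawing V, D.IsUpwardLeftward G ∧ D.IsOuterplanar G ∧ D.OnGrid ∧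
      (∀ d e : H.Dart, e.fst = d.fst →
        ¬ ((D.Precedes G d e ∧ D.Precedes G e (P.rot d)) ∨
          (D.Precedes G e (P.rot d) ∧ D.Precedes G (P.rot d) d) ∨
          (D.Precedes G (P.rot d) d ∧ D.Precedes G d e))) ∧
      (∀ d : H.Dart, (∀ v, D.y d.fst ≤ D.y v) → (∀ w, G.Adj d.fst w → D.y d.snd ≤ D.y w) →
        d ∈ P.outer) ∧
      (∀ d : H.Dart, G.Adj d.fst d.snd → (∀ v, D.x d.snd ≤ D.x v) →
        (∀ w, G.Adj w d.snd → D.x d.fst ≤ D.x w) → d ∈ P.outer) := by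
  rcases isEmpty_or_nonempty H.Dart with hE | hE
  · obtain ⟨D, h1, h2, h3⟩ := exists_drawing hG hadj hH hs
    exact ⟨D, h1, h2, h3, fun d => hE.elim d, fun d => hE.elim d, fun d => hE.elim d⟩
  let := reachOrder hG
  have h := isRootedCactus hG hadj hH hs
  have hnt' : ∀ r c d, G.Adj r c → G.Adj r d → c ≤ d → c = d := fun r c d hc hd hcd => by
    by_contra hne
    exact hnt r d ⟨hd, c, hne, hc, hcd⟩
  obtain ⟨I, st, hc⟩ := exists_isCut (P := P) h hP
  have hk := hc.isOuterplanarKey hnt'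
  obtain ⟨D, hD⟩ := LDrawing.exists_isDominance h hk
  exact ⟨D, hD.isUpwardLeftward h.toIsReachOrder, hD.isOuterplanar h hk, hD.onGrid,
    fun d e hde => hc.not_between hnt' hD hde, fun d => hc.mem_outer_of_lowest hnt' hD,
    fun d hd => hc.mem_outer_of_leftmost hnt' hD hd⟩

end Digraph

/-! ### Exchanging the coordinates -/

/-- The digraph with all edges reversed. -/
def Digraph.reversed {V : Type*} (G : Digraph V) : Digraph V where
  Adj u v := G.Adj v u

theorem Digraph.IsAcyclic.reversed {V : Type*} {G : Digraph V} (hG : G.IsAcyclic) :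
    G.reversed.IsAcyclic := fun v hv => hG v (Relation.transGen_swap.1 hv)

theorem mem_segment_swap {p q z : ℝ × ℝ} (hz : z ∈ segment ℝ p q) :
    z.swap ∈ segment ℝ p.swap q.swap := by
  obtain ⟨a, b, ha, hb, hab, rfl⟩ := hz
  exact ⟨a, b, ha, hb, hab, rfl⟩

theorem mem_openSegment_swap {p q z : ℝ × ℝ} (hz : z ∈ openSegment ℝ p q) :
    z.swap ∈ openSegment ℝ p.swap q.swap := by
  obtain ⟨a, b, ha, hb, hab, rfl⟩ := hz
  exact ⟨a, b, ha, hb, hab, rfl⟩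

namespace LDrawing

variable {V : Type*} {D : LDrawing V} {G : Digraph V}

/-- The reflection of a drawing in the main diagonal. It is an L-drawing of the reversed digraph, as
the bend of an edge becomes the bend of the reversed edge. -/
def swap (D : LDrawing V) : LDrawing V where
  x := D.y
  y := D.x
  x_injective := D.y_injective
  y_injective := D.x_injective

theorem IsUpwardLeftward.swap (hD : D.IsUpwardLeftward G.reversed) : D.swap.IsUpwardLeftward G :=
  fun _ _ huv => (hD (u := _) (v := _) huv).symm

theorem IsPlanar.swap (hD : D.IsPlanar G.reversed) : D.swap.IsPlanar G := by
  intro u v u' v' huv huv'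
  rw [Set.disjoint_left]
  intro z hz hz'
  have hdis := Set.disjoint_left.1 (hD (u := v') (v := u') (u' := v) (v' := u) huv' huv)
  refine @hdis z.swap ?_ ?_
  · rw [openSegment_symm]
    exact mem_openSegment_swap hz'
  · rw [openSegment_symm]
    exact mem_openSegment_swap hz

theorem swap_mem_support {z : ℝ × ℝ} (hz : z ∈ D.swap.support G) :
    z.swap ∈ D.support G.reversed := by
  rcases hz with ⟨v, rfl⟩ | ⟨u, v, huv, hz | hz⟩
  · exact .inl ⟨v, rfl⟩
  · refine .inr ⟨v, u, huv, .inr ?_⟩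
    rw [segment_symm]
    exact mem_segment_swap hz
  · refine .inr ⟨v, u, huv, .inl ?_⟩
    rw [segment_symm]
    exact mem_segment_swap hz

theorem swap_mem_outerFace {z : ℝ × ℝ} (hz : z ∈ D.outerFace G.reversed) :
    z.swap ∈ D.swap.outerFace G := by
  refine ⟨fun h => hz.1 (swap_mem_support h), fun hb => hz.2 ?_⟩
  have hsub : Prod.swap '' connectedComponentIn (D.support G.reversed)ᶜ z ⊆
      connectedComponentIn (D.swap.support G)ᶜ z.swap := by
    refine (isPreconnected_connectedComponentIn.image _
      continuous_swap.continuousOn).subset_connectedComponentIn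
        ⟨z, mem_connectedComponentIn hz.1, rfl⟩ ?_
    rintro _ ⟨w, hw, rfl⟩ hmem
    exact connectedComponentIn_subset _ _ hw (swap_mem_support hmem)
  have hb' := hb.subset hsub
  rw [← Bornology.isBounded_image_fst_and_snd, Set.image_image, Set.image_image] at hb'
  exact Bornology.isBounded_image_fst_and_snd.1 hb'.symm

theorem IsOuterplanar.swap (hD : D.IsOuterplanar G.reversed) : D.swap.IsOuterplanar G := by
  refine ⟨hD.1.swap, fun v => ?_⟩
  refine closure_mono ?_ (image_closure_subset_closure_image continuous_swap ⟨_, hD.2 v, rfl⟩)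
  rintro _ ⟨z, hz, rfl⟩
  exact swap_mem_outerFace hz

theorem OnGrid.swap (hD : D.OnGrid) : D.swap.OnGrid := ⟨hD.2, hD.1⟩

theorem precedes_swap {H : SimpleGraph V} {d e : H.Dart} (h : D.swap.Precedes G d e) :
    D.Precedes G.reversed e d := by
  rcases h with ⟨h1, h2⟩ | ⟨h1, h2, h3⟩ | ⟨h1, h2, h3⟩
  · exact .inl ⟨h2, h1⟩
  · exact .inr (.inr ⟨h2, h1, h3⟩)
  · exact .inr (.inl ⟨h2, h1, h3⟩)

end LDrawing

namespace PlaneEmbedding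

open SimpleGraph

variable {V : Type*} {H : SimpleGraph V}

theorem sameCycle_facePerm_inv {rot : Equiv.Perm H.Dart} {d e : H.Dart} :
    (facePerm rot⁻¹).SameCycle d e ↔ (facePerm rot).SameCycle d.symm e.symm := by
  let σ : Equiv.Perm H.Dart := (Dart.symm_involutive (G := H)).toPerm
  have hσ : σ⁻¹ = σ := rfl
  have h1 : facePerm rot⁻¹ = σ * (facePerm rot)⁻¹ * σ⁻¹ := by
    change rot⁻¹⁻¹ * σ = σ * (rot⁻¹ * σ)⁻¹ * σ⁻¹
    rw [mul_inv_rev, mul_inv_cancel_left, hσ]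
  rw [h1, Equiv.Perm.sameCycle_conj, Equiv.Perm.sameCycle_inv]
  rfl

/-- The mirror image of a plane embedding. The face to the left of a dart becomes the face to the
left of the reversed dart. -/
def mirror (P : PlaneEmbedding H) : PlaneEmbedding H where
  rot := P.rot⁻¹
  rot_fst := P.rot_inv_fst
  rot_cyclic d e hde := (P.rot_cyclic d e hde).inv
  euler := by
    have h1 : Nat.card (Quotient (Equiv.Perm.SameCycle.setoid (facePerm P.rot⁻¹))) =
        Nat.card (Quotient (Equiv.Perm.SameCycle.setoid (facePerm P.rot))) :=
      Nat.card_congr (Quotient.congr (Dart.symm_involutive (G := H)).toPerm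
        fun _ _ => sameCycle_facePerm_inv)
    rw [numFaces, h1]
    exact P.euler
  outer := {d | d.symm ∈ P.outer}
  outer_face := by
    refine P.outer_face.imp_left ?_
    rintro ⟨d, hd⟩
    refine ⟨d.symm, ?_⟩
    rw [hd]
    ext e
    change _ ↔ (facePerm P.rot⁻¹).SameCycle d.symm e
    rw [sameCycle_facePerm_inv, Dart.symm_symm]
    rfl

theorem IsOuterplanar.mirror {P : PlaneEmbedding H} (hP : P.IsOuterplanar) :
    P.mirror.IsOuterplanar := by
  refine hP.imp_left fun h v => ?_
  obtain ⟨d, hd, rfl⟩ := h v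
  -- The dart before `d` on the boundary of the outer face leads to `d.fst`.
  refine ⟨P.rot d, ?_, P.rot_fst d⟩
  change (P.rot d).symm ∈ P.outer
  rcases P.outer_face with ⟨e, he⟩ | he
  · rw [he] at hd ⊢
    rw [← facePerm_symm_rot (rot := P.rot) d] at hd
    exact Equiv.Perm.sameCycle_apply_right.1 hd
  · exact he.elim d

end PlaneEmbedding

namespace Digraph

variable {V : Type*} {G : Digraph V}

theorem toSimpleGraphInclusive_adj_iff (hG : G.IsAcyclic) (u v : V) :
    G.toSimpleGraphInclusive.Adj u v ↔ G.Adj u v ∨ G.Adj v u := by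
  rw [toSimpleGraphInclusive, SimpleGraph.fromRel_adj, and_iff_right_iff_imp]
  rintro h rfl
  exact hG u (.single (h.elim id id))

/-- A transitive edge and the other path between its ends contain a cycle. -/
theorem not_isTransitiveEdge_of_isTree [Finite V] (hG : G.IsAcyclic)
    (hT : G.toSimpleGraphInclusive.IsTree) (u v : V) : ¬ G.IsTransitiveEdge u v := by
  rintro ⟨huv, w, hwv, huw, hle⟩
  let := reachOrder hG
  have h := isReachOrder hG (toSimpleGraphInclusive_adj_iff hG)
  obtain ⟨t, B, -⟩ := h.exists_bigon_root huw huv hwv hle le_rfl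
  exact hT.isAcyclic _ (B.isCycle h)

end Digraph

theorem mainTheorem3 {V : Type*} [Finite V] (G : Digraph V)
    (hacyclic : G.IsAcyclic)
    (hcactus : G.toSimpleGraphInclusive.IsCactus)
    (hsource_or_sink : (∃! s, G.IsSource s) ∨ (∃! t, G.IsSink t)) :
    (∃ D : LDrawing V, D.IsUpwardLeftward G ∧ D.IsOuterplanar G ∧ D.OnGrid) ∧
    ((∀ u v, ¬ G.IsTransitiveEdge u v) →
      ∀ P : PlaneEmbedding G.toSimpleGraphInclusive, P.IsOuterplanar →
        ∃ D : LDrawing V, D.IsUpwardLeftward G ∧ D.IsOuterplanar G ∧ D.OnGrid ∧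
          D.Maintains G P) ∧
    (G.toSimpleGraphInclusive.IsTree → ∀ u v, ¬ G.IsTransitiveEdge u v) := by
  have hadj := Digraph.toSimpleGraphInclusive_adj_iff hacyclic
  have htree := Digraph.not_isTransitiveEdge_of_isTree hacyclic
  rcases hsource_or_sink with ⟨s, -, hs⟩ | ⟨t, -, ht⟩
  · refine ⟨Digraph.exists_drawing hacyclic hadj hcactus hs, fun hnt P hP => ?_, htree⟩
    obtain ⟨D, h1, h2, h3, h4, h5, -⟩ :=
      Digraph.exists_drawing_of_embedding hacyclic hadj hcactus hs hnt P hP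
    exact ⟨D, h1, h2, h3, h4, h5⟩
  · have hadj' : ∀ u v, G.toSimpleGraphInclusive.Adj u v ↔
        G.reversed.Adj u v ∨ G.reversed.Adj v u := fun u v => (hadj u v).trans or_comm
    refine ⟨?_, fun hnt P hP => ?_, htree⟩
    · obtain ⟨D, h1, h2, h3⟩ := Digraph.exists_drawing hacyclic.reversed hadj' hcactus ht
      exact ⟨D.swap, h1.swap, h2.swap, h3.swap⟩
    · have hnt' : ∀ u v, ¬ G.reversed.IsTransitiveEdge u v := by
        rintro u v ⟨huv, w, hwv, huw, hle⟩
        have hle' : Relation.ReflTransGen G.Adj v w := Relation.reflTransGen_swap.1 hle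
        rcases Relation.ReflTransGen.cases_head hle' with h | ⟨w', hvw', hw'⟩
        · exact hwv h.symm
        · refine hnt v u ⟨huv, w', ?_, hvw', hw'.tail huw⟩
          rintro rfl
          exact hacyclic w' (.tail' hw' huw)
      obtain ⟨D, h1, h2, h3, h4, -, h6⟩ := Digraph.exists_drawing_of_embedding
        hacyclic.reversed hadj' hcactus ht hnt' P.mirror hP.mirror
      refine ⟨D.swap, h1.swap, h2.swap, h3.swap, fun d e hde hb => ?_, fun d hv hw => ?_⟩
      · have h7 := h4 (P.rot d) e (hde.trans (P.rot_fst d).symm)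
        rw [show P.mirror.rot (P.rot d) = d from P.rot.symm_apply_apply d] at h7
        refine h7 ?_
        have hp := fun {d e : G.toSimpleGraphInclusive.Dart}
          (h : D.swap.CcwBefore G d e) => LDrawing.precedes_swap h
        rcases hb with ⟨h8, h9⟩ | ⟨h8, h9⟩ | ⟨h8, h9⟩
        · exact .inl ⟨hp h9, hp h8⟩
        · exact .inr (.inr ⟨hp h9, hp h8⟩)
        · exact .inr (.inl ⟨hp h9, hp h8⟩)
      · -- The reversal of `d` is an edge into the leftmost vertex of the unreflected drawing.
        have hd : G.Adj d.fst d.snd := ((hadj _ _).1 d.adj).resolve_right fun h =>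
          (hv d.snd).not_gt (h1.swap h).1
        exact h6 d.symm hd hv hw
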